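/- **Setting.** Let $L$ be a lattice of rank $n$, $L^*=\mathrm{Hom}(L,\mathbb Z)$, and let $\Delta=(\Sigma,C,w^\pm)$ be a complete simplicial multi-fan of dimension $n$ in $L$. That is, $\Sigma$ is a finite simplicial complex including the empty simplex, $\Sigma^{(k)}$ is its set of simplices with $k$ vertices, and $\Sigma^{(n)}\neq\emptyset$. The map $C$ assigns to $J\in\Sigma^{(k)}$ a $k$-dimensional rational simplicial cone in $L_{\mathbb R}$ generated by the rays $C(\{j\})$, $j\in J$. Further, $w^\pm:\Sigma^{(n)}\to\mathbb Z_{\ge0}$ and $w=w^+-w^-$. For $K\in\Sigma$ let $(L_K)_{\mathbb R}$ be the span of $C(K)$, and let $C_K(J)$, $J\supset K$, be the image of $C(J)$ in $L_{\mathbb R}/(L_K)_{\mathbb R}$. Completeness means that for every $K\in\Sigma$ the integer $\sum_{I\in\Sigma^{(n)},\,I\supset K,\,x\in C_K(I)}w(I)$ is the same for all generic $x\in L_{\mathbb R}/(L_K)_{\mathbb R}$ (those on no linear span of a cone $C_K(J)$, $K\subset J$, $|J|<n$). This integer is $\deg(\Delta_K)$. Let $\mathcal V=\{v_i\in L\}_{i\in\Sigma^{(1)}}$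 be vectors such that $v_i$ generates the ray $C(\{i\})$ (not necessarily primitive). For $K\in\Sigma$ let $L_K=L\cap (L_K)_{\mathbb R}$, let $L_{K,\mathcal V}$ be the sublattice generated by $v_i$, $i\in K$, and let $H_K=L_K/L_{K,\mathcal V}$, a finite group; for $I\in\Sigma^{(n)}$, $H_I=L/L_{I,\mathcal V}$. Let $(u_i^K)_{i\in K}$ be the basis dual to $(v_i)_{i\in K}$, and for $h\in H_K$ with a representative $v(h)\in L_K$ let $f_{K,h,i}\in[0,1)$ be the fractional part of $\langle u_i^K,v(h)\rangle$. Put $f_{K,h}=\sum_{i\in K}f_{K,h,i}$ and $v_{K,h}=\sum_{i\in K}f_{K,h,i}v_i$. For $\tau$ in the upper half plane and $\sigma\in\mathbb C$ write $q=e^{2\pi\sqrt{-1}\tau}$, $\zeta=e^{2\pi\sqrt{-1}\sigma}$, with $q^x=e^{2\pi\sqrt{-1}x\tau}$ and $\zeta^x=e^{2\pi\sqrt{-1}x\sigma}$ for real $x$, and $$\Phi(z,\tau)=(s^{1/2}-s^{-1/2})\prod_{k\ge1}\frac{(1-sq^k)(1-s^{-1}q^k)}{(1-q^k)^2},\quad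 s^{\pm1/2}=e^{\pm\pi\sqrt{-1}z},\qquad \phi(z,\tau,\sigma)=\frac{\Phi(z+\sigma,\tau)}{\Phi(z,\tau)} .$$ The equivariant orbifold elliptic genus is the following meromorphic function of $(w,\tau,\sigma)$, $w\in L_{\mathbb C}=L\otimes\mathbb C$: $$\hat\varphi(\Delta,\mathcal V)=\sum_{I\in\Sigma^{(n)}}\frac{w(I)}{|H_I|}\sum_{(h_1,h_2)\in H_I\times H_I}\ \prod_{i\in I}\zeta^{\langle u_i^I,v(h_1)\rangle}\,\phi\big(\langle u_i^I,-w+\tau v(h_1)-v(h_2)\rangle,\tau,\sigma\big).$$ For $v\in L_{\mathcal V}=\bigcap_{I\in\Sigma^{(n)}}L_{I,\mathcal V}$ generic (that is, $\langle u_i^I,v\rangle\ne0$ for all $I\in\Sigma^{(n)}$, $i\in I$), the genus along $v$, $\hat\varphi^v(\Delta,\mathcal V)$, is the same expression with $w$ replaced by $zv$, $z\in\mathbb C$. For $u\in L^*$, $t^u$ denotes the function $w\mapsto e^{2\pi\sqrt{-1}\langle u,w\rangle}$. **Theorem.** One has the equality of meromorphic functions $$\hat\varphi(\Delta,\mathcal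 V)=\sum_{u\in L^*}t^{-u}\left(\sum_{k=0}^n\ \sum_{J\in\Sigma^{(k)},\,h\in H_J}(-1)^k\deg(\Delta_J)\,\zeta^{f_{J,h}}q^{\langle u,v_{J,h}\rangle}\prod_{i\in J}\frac1{1-\zeta q^{\langle u,v_i\rangle}}\right)\Phi(\sigma,\tau)^n .$$ More precisely, let $\zeta q^m\neq1$ for all $m\in\mathbb Z$, and suppose that for all $I\in\Sigma^{(n)}$ and $i\in I$ the number $y=\mathrm{Im}\,\langle u_i^I,w\rangle$ satisfies $0<|y|<\mathrm{Im}\,\tau$ and, for every $h\in H_I$ with $f=f_{I,h,i}\ne0$, also $|y|<f\,\mathrm{Im}\,\tau$ and $|y|<(1-f)\,\mathrm{Im}\,\tau$. Then the series converges absolutely to $\hat\varphi(\Delta,\mathcal V)$ at $(w,\tau,\sigma)$. In particular, for every generic $v\in L_{\mathcal V}$ and every $z\in\mathbb C$ such that $w=zv$ satisfies these inequalities, the series with $t^{-u}$ replaced by $e^{-2\pi\sqrt{-1}\langle u,v\rangle z}$ converges absolutely to $\hat\varphi^v(\Delta,\mathcal V)$. -/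

import Mathlib

open scoped TensorProduct
open Module

noncomputable section

/-- `eTwoPi z = exp (2π√-1 z)`.  With `q = eTwoPi τ`, `ζ = eTwoPi σ` and
`t^u = eTwoPi ⟨u, w⟩`, real powers are `q^x = eTwoPi (x τ)` and `ζ^x = eTwoPi (x σ)`. -/
def eTwoPi (z : ℂ) : ℂ := Complex.exp (2 * Real.pi * Complex.I * z)

/-- The Jacobi form `Φ(z,τ) = (t^{1/2} - t^{-1/2}) ∏_{k ≥ 1} (1 - t q^k)(1 - t⁻¹ q^k)/(1 - q^k)^2`
with `t = eTwoPi z` and `q = eTwoPi τ`. -/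
def jacobiPhi (z : ℂ) (τ : UpperHalfPlane) : ℂ :=
  (eTwoPi (z / 2) - eTwoPi (-z / 2)) *
    ∏' k : ℕ, ((1 - eTwoPi z * eTwoPi τ ^ (k + 1)) * (1 - (eTwoPi z)⁻¹ * eTwoPi τ ^ (k + 1))) /
      (1 - eTwoPi τ ^ (k + 1)) ^ 2

/-- `φ(z,τ,σ) = Φ(z+σ,τ)/Φ(z,τ)`. -/
def ellPhi (z : ℂ) (τ : UpperHalfPlane) (σ : ℂ) : ℂ :=
  jacobiPhi (z + σ) τ / jacobiPhi z τ

/-- A simplicial multi-fan `Δ = (Σ, C, w⁺, w⁻)` in the lattice `L`, of dimension `n = rank L`, whose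
simplicial complex `Σ` (augmented by `∅`) has its vertices in `ι`.  The cone of a vertex is a
rational ray, and the cone of a `k`-element simplex `J` is generated by the rays of the vertices of
`J` and has dimension `k`; so it is a strongly convex rational simplicial cone, and its faces are
exactly the cones of the subsets of `J`. -/
structure SimplicialMultiFan (ι L : Type*) [AddCommGroup L] where
  /-- the simplices of `Σ` -/
  faces : Finset (Finset ι)
  empty_mem : ∅ ∈ faces
  down_closed : ∀ I ∈ faces, ∀ J ⊆ I, J ∈ faces
  exists_top : ∃ I ∈ faces, I.card = finrank ℤ L
  /-- the map `C` (its values off `Σ` play no role) -/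
  cone : Finset ι → PointedCone ℝ (ℝ ⊗[ℤ] L)
  cone_vertex : ∀ i, {i} ∈ faces → ∃ x : L, cone {i} = PointedCone.hull ℝ {(1 : ℝ) ⊗ₜ[ℤ] x}
  cone_eq : ∀ J ∈ faces, cone J = ⨆ j ∈ J, cone {j}
  finrank_cone : ∀ J ∈ faces,
    finrank ℝ (Submodule.span ℝ (cone J : Set (ℝ ⊗[ℤ] L))) = J.card
  wpos : {I : Finset ι // I ∈ faces.filter (fun I => I.card = finrank ℤ L)} → ℕ
  wneg : {I : Finset ι // I ∈ faces.filter (fun I => I.card = finrank ℤ L)} → ℕ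

namespace SimplicialMultiFan

variable {ι L : Type*} [AddCommGroup L] (Δ : SimplicialMultiFan ι L)

/-- The simplices of `Σ`, including `∅`. -/
abbrev Simplex : Type _ := {J : Finset ι // J ∈ Δ.faces}

/-- `Σ^(n)`: the simplices with `n = rank L` vertices. -/
abbrev Facet : Type _ := {I : Finset ι // I ∈ Δ.faces.filter (fun I => I.card = finrank ℤ L)}

/-- `Σ^(k)`: the simplices with `k` vertices. -/
def skeleton (k : ℕ) : Finset Δ.Simplex := Finset.univ.filter (fun J => J.1.card = k)

variable {Δ} in
/-- A top-dimensional simplex, as a simplex. -/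
def Facet.toSimplex (I : Δ.Facet) : Δ.Simplex := ⟨I.1, (Finset.mem_filter.1 I.2).1⟩

/-- `w(I) = w⁺(I) - w⁻(I)`. -/
def w (I : Δ.Facet) : ℤ := (Δ.wpos I : ℤ) - (Δ.wneg I : ℤ)

/-- `(L_K)_ℝ`: the linear span of the cone `C(K)`. -/
def spanCone (K : Δ.Simplex) : Submodule ℝ (ℝ ⊗[ℤ] L) :=
  Submodule.span ℝ (Δ.cone K.1 : Set (ℝ ⊗[ℤ] L))

/-- The cone `C_K(J)` of the projected multi-fan `Δ_K`: the image of `C(J)` in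
`L^K_ℝ = L_ℝ / (L_K)_ℝ`. -/
def projCone (K J : Δ.Simplex) : PointedCone ℝ ((ℝ ⊗[ℤ] L) ⧸ Δ.spanCone K) :=
  (Δ.cone J.1).map (Δ.spanCone K).mkQ

/-- Generic vectors of `L^K_ℝ` for the projected multi-fan `Δ_K`: those on no linear span of a cone
`C_K(J)`, `K ⊆ J`, of dimension `|J| - |K| < n - |K|`. -/
def IsGenericProj (K : Δ.Simplex) (x : (ℝ ⊗[ℤ] L) ⧸ Δ.spanCone K) : Prop :=
  ∀ J : Δ.Simplex, K.1 ⊆ J.1 → J.1.card < finrank ℤ L →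
    x ∉ Submodule.span ℝ (Δ.projCone K J : Set ((ℝ ⊗[ℤ] L) ⧸ Δ.spanCone K))

open Classical in
/-- `d_x = ∑ w(I)` for the projected multi-fan `Δ_K`, over the `I ∈ Σ^(n)` with `K ⊆ I` and
`x ∈ C_K(I)`. -/
def dProj (K : Δ.Simplex) (x : (ℝ ⊗[ℤ] L) ⧸ Δ.spanCone K) : ℤ :=
  ∑ I : Δ.Facet with K.1 ⊆ I.1 ∧ x ∈ Δ.projCone K I.toSimplex, Δ.w I

/-- The projected multi-fan `Δ_K` is pre-complete. -/
def IsPrecomplete (K : Δ.Simplex) : Prop :=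
  ∃ d : ℤ, ∀ x, Δ.IsGenericProj K x → Δ.dProj K x = d

/-- `Δ` is complete: all projected multi-fans (among them `Δ_∅ = Δ`) are pre-complete. -/
def IsComplete : Prop := ∀ K : Δ.Simplex, Δ.IsPrecomplete K

open Classical in
/-- The degree `deg(Δ_K)` of the projected multi-fan: the common value of `d_x` for generic `x`
(generic vectors exist, so it is unique; it is set to `0` if `Δ_K` is not pre-complete). -/
def deg (K : Δ.Simplex) : ℤ := if h : Δ.IsPrecomplete K then h.choose else 0

/-- `L_K`: the kernel of `L → L^K`, that is the lattice vectors lying in `(L_K)_ℝ`. -/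
def latticeOf (K : Δ.Simplex) : Submodule ℤ L where
  carrier := {x | (1 : ℝ) ⊗ₜ[ℤ] x ∈ Δ.spanCone K}
  add_mem' {x y} hx hy := by
    simpa only [Set.mem_ofPred_eq, TensorProduct.tmul_add] using Submodule.add_mem _ hx hy
  zero_mem' := by simp
  smul_mem' c x hx := by
    have h := Submodule.smul_mem (Δ.spanCone K) (c : ℝ) hx
    rwa [Int.cast_smul_eq_zsmul, ← TensorProduct.tmul_smul] at h

/-- A set `𝒱 = {v_i}` of lattice vectors such that `v_i` generates the ray `C({i})` for each vertex
`i ∈ Σ^(1)`; it need not be primitive. -/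
structure GeneratingVectors where
  vec : ι → L
  cone_eq_hull : ∀ i, {i} ∈ Δ.faces → Δ.cone {i} = PointedCone.hull ℝ {(1 : ℝ) ⊗ₜ[ℤ] vec i}

namespace GeneratingVectors

variable {Δ} (V : Δ.GeneratingVectors)

/-- `(v_i)_{i ∈ K}` in `L_ℝ`. -/
def real (K : Finset ι) (i : K) : ℝ ⊗[ℤ] L := (1 : ℝ) ⊗ₜ[ℤ] V.vec i

theorem spanCone_eq (K : Δ.Simplex) :
    Δ.spanCone K = Submodule.span ℝ (Set.range (V.real K.1)) := by
  have hc : Δ.cone K.1 = PointedCone.hull ℝ (Set.range (V.real K.1)) := by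
    rw [Δ.cone_eq K.1 K.2]
    have h : ∀ j ∈ K.1, Δ.cone {j} = PointedCone.hull ℝ {(1 : ℝ) ⊗ₜ[ℤ] V.vec j} := fun j hj =>
      V.cone_eq_hull j (Δ.down_closed K.1 K.2 _ (by simpa using hj))
    apply le_antisymm
    · refine iSup₂_le fun j hj => ?_
      rw [h j hj]
      exact Submodule.span_mono (by rintro _ rfl; exact ⟨⟨j, hj⟩, rfl⟩)
    · refine Submodule.span_le.2 ?_
      rintro _ ⟨j, rfl⟩
      have : V.real K.1 j ∈ Δ.cone {j.1} := by
        rw [h j.1 j.2]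
        exact Submodule.subset_span rfl
      exact (le_iSup₂_of_le (f := fun (j : ι) (_ : j ∈ K.1) => Δ.cone {j}) j.1 j.2 le_rfl) this
  unfold spanCone
  rw [hc]
  exact Submodule.span_span_of_tower _ _ _

theorem linearIndependent (K : Δ.Simplex) : LinearIndependent ℝ (V.real K.1) := by
  rw [linearIndependent_iff_card_eq_finrank_span, Set.finrank, ← V.spanCone_eq K]
  rw [Fintype.card_coe]
  exact (Δ.finrank_cone K.1 K.2).symm

/-- The basis `(v_i)_{i ∈ K}` of `(L_K)_ℝ`. -/
def spanBasis (K : Δ.Simplex) : Basis K.1 ℝ (Δ.spanCone K) :=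
  (Basis.span (V.linearIndependent K)).map (LinearEquiv.ofEq _ _ (V.spanCone_eq K).symm)

/-- `L_{K,𝒱}`: the sublattice generated by the `v_i`, `i ∈ K`. -/
def sublattice (K : Finset ι) : Submodule ℤ L := Submodule.span ℤ (V.vec '' (K : Set ι))

/-- `H_K = L_K / L_{K,𝒱}`.  For `K ∈ Σ^(n)` one has `L_K = L`, so that this is `L / L_{K,𝒱}`. -/
abbrev H (K : Δ.Simplex) : Type _ :=
  Δ.latticeOf K ⧸ (V.sublattice K.1).submoduleOf (Δ.latticeOf K)

theorem finite_H [Module.Free ℤ L] [Module.Finite ℤ L] (K : Δ.Simplex) : Finite (V.H K) := by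
  apply Submodule.finiteQuotientOfFreeOfRankEq
  apply le_antisymm (Submodule.finrank_le _)
  have hle : finrank ℤ (Δ.latticeOf K) ≤ K.1.card := by
    rw [← Module.finrank_baseChange (R := ℝ) (S := ℤ) (M' := Δ.latticeOf K)]
    have hinj : Function.Injective ((Δ.latticeOf K).subtype.baseChange ℝ) :=
      Module.Flat.lTensor_preserves_injective_linearMap (M := ℝ) _
        (Δ.latticeOf K).injective_subtype
    rw [← LinearMap.finrank_range_of_inj hinj, ← Δ.finrank_cone K.1 K.2]
    apply Submodule.finrank_mono
    rintro _ ⟨x, rfl⟩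
    induction x using TensorProduct.induction_on with
    | zero => simp
    | add x y hx hy => rw [map_add]; exact Submodule.add_mem _ hx hy
    | tmul r x =>
      have hx : (1 : ℝ) ⊗ₜ[ℤ] (x : L) ∈ Δ.spanCone K := x.2
      have h := Submodule.smul_mem _ r hx
      rw [TensorProduct.smul_tmul', smul_eq_mul, mul_one] at h
      exact h
  refine hle.trans ?_
  have hli : LinearIndependent ℤ (fun i : K.1 => V.vec i) := by
    have h1 : LinearIndependent ℤ (V.real K.1) :=
      (V.linearIndependent K).restrict_scalars (by
        intro a b h
        simpa using h)
    exact LinearIndependent.of_comp (TensorProduct.mk ℤ ℝ L 1) h1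
  have hmem : ∀ i : K.1, V.vec i ∈ Δ.latticeOf K := fun i => by
    change (1 : ℝ) ⊗ₜ[ℤ] V.vec i ∈ Δ.spanCone K
    rw [V.spanCone_eq K]
    exact Submodule.subset_span ⟨i, rfl⟩
  let g : K.1 → (V.sublattice K.1).submoduleOf (Δ.latticeOf K) := fun i =>
    ⟨⟨V.vec i, hmem i⟩, Submodule.subset_span ⟨i.1, i.2, rfl⟩⟩
  have hg : LinearIndependent ℤ g :=
    LinearIndependent.of_comp
      ((Δ.latticeOf K).subtype ∘ₗ ((V.sublattice K.1).submoduleOf (Δ.latticeOf K)).subtype) hli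
  simpa using hg.fintype_card_le_finrank

instance [Module.Free ℤ L] [Module.Finite ℤ L] (K : Δ.Simplex) : Fintype (V.H K) :=
  letI := V.finite_H K
  Fintype.ofFinite _

/-- A representative `v(h) ∈ L_K` of `h ∈ H_K`. -/
def rep {K : Δ.Simplex} (h : V.H K) : Δ.latticeOf K := Quotient.out h

/-- `f_{K,h,i} ∈ [0,1)`: the fractional part of `⟨u_i^K, v(h)⟩`, where `(u_i^K)` is the basis dual to
`(v_i)_{i ∈ K}`.  Equivalently the value of `⟨u_i^K, v(h)⟩` for the representative `v(h)` all of
whose coordinates lie in `[0,1)`. -/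
def f (K : Δ.Simplex) (h : V.H K) (i : K.1) : ℝ :=
  Int.fract ((V.spanBasis K).coord i ⟨(1 : ℝ) ⊗ₜ[ℤ] (V.rep h : L), (V.rep h).2⟩)

/-- `f_{K,h} = ∑_{i ∈ K} f_{K,h,i}`. -/
def fSum (K : Δ.Simplex) (h : V.H K) : ℝ := ∑ i : K.1, V.f K h i

/-- `v_{K,h} = ∑_{i ∈ K} f_{K,h,i} v_i`. -/
def vSum (K : Δ.Simplex) (h : V.H K) : ℝ ⊗[ℤ] L := ∑ i : K.1, V.f K h i • V.real K.1 i

/-- The basis `(v_i)_{i ∈ I}` of `L_ℝ` for `I ∈ Σ^(n)`. -/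
def facetBasis [Module.Free ℤ L] [Module.Finite ℤ L] (I : Δ.Facet) : Basis I.1 ℝ (ℝ ⊗[ℤ] L) :=
  Basis.mk (V.linearIndependent I.toSimplex) (by
    have h1 := V.spanCone_eq I.toSimplex
    have h2 : Δ.spanCone I.toSimplex = ⊤ := by
      apply Submodule.eq_top_of_finrank_eq
      rw [Module.finrank_baseChange, ← (Finset.mem_filter.1 I.2).2]
      exact Δ.finrank_cone I.1 I.toSimplex.2
    exact (h2.symm.trans h1).le)

/-- The dual basis vector `u_i^I ∈ L_ℝ^*`, `I ∈ Σ^(n)`. -/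
def dualVec [Module.Free ℤ L] [Module.Finite ℤ L] (I : Δ.Facet) (i : I.1) :
    Module.Dual ℝ (ℝ ⊗[ℤ] L) := (V.facetBasis I).coord i

/-- `u_i^I` extended to a `ℂ`-linear form on `L_ℂ = ℂ ⊗ L`. -/
def dualVecC [Module.Free ℤ L] [Module.Finite ℤ L] (I : Δ.Facet) (i : I.1) :
    (ℂ ⊗[ℤ] L) →ₗ[ℂ] ℂ :=
  (AddMonoidHom.mk' (fun x : L => ((V.dualVec I i ((1 : ℝ) ⊗ₜ[ℤ] x) : ℝ) : ℂ)) (fun x y => by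
    rw [TensorProduct.tmul_add, map_add, Complex.ofReal_add])).toIntLinearMap.liftBaseChange ℂ

/-- `L_𝒱 = ⋂_{I ∈ Σ^(n)} L_{I,𝒱}`. -/
def commonLattice : Submodule ℤ L := ⨅ I : Δ.Facet, V.sublattice I.1

/-- `x ∈ L` is generic: `⟨u_i^I, x⟩ ≠ 0` for all `I ∈ Σ^(n)` and `i ∈ I`. -/
def IsGeneric [Module.Free ℤ L] [Module.Finite ℤ L] (x : L) : Prop :=
  ∀ (I : Δ.Facet) (i : I.1), V.dualVec I i ((1 : ℝ) ⊗ₜ[ℤ] x) ≠ 0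

/-- The equivariant orbifold elliptic genus, as a function of `(w, τ, σ)`, `w ∈ L_ℂ`:
`∑_{I ∈ Σ^(n)} w(I)/|H_I| ∑_{(h₁,h₂) ∈ H_I × H_I}
  ∏_{i ∈ I} ζ^{⟨u_i^I, v(h₁)⟩} φ(⟨u_i^I, -w + τ v(h₁) - v(h₂)⟩, τ, σ)`. -/
def orbEllGenus [Module.Free ℤ L] [Module.Finite ℤ L]
    (w : ℂ ⊗[ℤ] L) (τ : UpperHalfPlane) (σ : ℂ) : ℂ :=
  ∑ I : Δ.Facet, ((Δ.w I : ℂ) / (Nat.card (V.H I.toSimplex) : ℂ)) *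
    ∑ h : V.H I.toSimplex × V.H I.toSimplex, ∏ i : I.1,
      eTwoPi (V.dualVec I i ((1 : ℝ) ⊗ₜ[ℤ] (V.rep h.1 : L)) * σ) *
        ellPhi (V.dualVecC I i
          (-w + (τ : ℂ) ⊗ₜ[ℤ] (V.rep h.1 : L) - (1 : ℂ) ⊗ₜ[ℤ] (V.rep h.2 : L))) τ σ

/-- The equivariant orbifold elliptic genus along `x ∈ L`, as a function of `(z, τ, σ)`. -/
def orbEllGenusAlong [Module.Free ℤ L] [Module.Finite ℤ L]
    (x : L) (z : ℂ) (τ : UpperHalfPlane) (σ : ℂ) : ℂ :=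
  ∑ I : Δ.Facet, ((Δ.w I : ℂ) / (Nat.card (V.H I.toSimplex) : ℂ)) *
    ∑ h : V.H I.toSimplex × V.H I.toSimplex, ∏ i : I.1,
      eTwoPi (V.dualVec I i ((1 : ℝ) ⊗ₜ[ℤ] (V.rep h.1 : L)) * σ) *
        ellPhi (V.dualVecC I i
          (-(z ⊗ₜ[ℤ] x) + (τ : ℂ) ⊗ₜ[ℤ] (V.rep h.1 : L) - (1 : ℂ) ⊗ₜ[ℤ] (V.rep h.2 : L))) τ σ

/-- The coefficient of `t^{-u}` in the character formula, up to the factor `Φ(σ,τ)^n`: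
`∑_{k=0}^n ∑_{J ∈ Σ^(k), h ∈ H_J} (-1)^k deg(Δ_J) ζ^{f_{J,h}} q^{⟨u, v_{J,h}⟩}
  ∏_{i ∈ J} 1 / (1 - ζ q^{⟨u, v_i⟩})`. -/
def charCoeff [Module.Free ℤ L] [Module.Finite ℤ L]
    (u : Module.Dual ℤ L) (τ : UpperHalfPlane) (σ : ℂ) : ℂ :=
  ∑ k ∈ Finset.range (finrank ℤ L + 1), ∑ J ∈ Δ.skeleton k, ∑ h : V.H J,
    (-1) ^ k * (Δ.deg J : ℂ) * eTwoPi (V.fSum J h * σ) *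
      eTwoPi ((u.baseChange ℝ (V.vSum J h) : ℝ) * τ) *
      ∏ i ∈ J.1, 1 / (1 - eTwoPi σ * eTwoPi τ ^ (u (V.vec i)))

/-- The domain of convergence.  With `y = Im ⟨u_i^I, w⟩` it requires `0 < |y| < Im τ` for all
`I ∈ Σ^(n)`, `i ∈ I`, and `|y| < f Im τ`, `|y| < (1 - f) Im τ` for every `f = f_{I,h,i} ≠ 0`,
`h ∈ H_I`. -/
def InDomain [Module.Free ℤ L] [Module.Finite ℤ L] (w : ℂ ⊗[ℤ] L) (τ : UpperHalfPlane) : Prop :=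
  ∀ (I : Δ.Facet) (i : I.1),
    0 < |(V.dualVecC I i w).im| ∧ |(V.dualVecC I i w).im| < τ.im ∧
    ∀ h : V.H I.toSimplex, V.f I.toSimplex h i ≠ 0 →
      |(V.dualVecC I i w).im| < V.f I.toSimplex h i * τ.im ∧
      |(V.dualVecC I i w).im| < (1 - V.f I.toSimplex h i) * τ.im

end GeneratingVectors

end SimplicialMultiFan

end

/-! ### The exponential and q-products. -/

section

open Filter Topology Complex

/-! The analytic input is Kronecker's identity: for `0 < Im z < Im τ`, with `s = e^{2πiz}`, one has
`Φ(z+σ)/(Φ(z)Φ(σ)) = -∑_m s^m/(1-ζq^m)`. As functions of `σ` both sides are multiplied by the same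
factors under `σ ↦ σ+1` and `σ ↦ σ+τ`, and their simple poles at the lattice points cancel. The
difference therefore extends to an entire quasi-periodic function, which Liouville's theorem forces
to vanish (`kroneckerDefect_eq_zero`). By quasi-periodicity `ζ^d φ(-a+τd)` depends on `d` only
through its fractional part, and this gives its expansion in powers of `e^{-2πia}`
(`hasSum_ellPhi_fract`). When `d` is integral and `Im a > 0`, the argument must first be moved into
the strip, which replaces `1/(1-ζq^m)` by `1/(1-ζq^m) - 1`.

Multiplying these expansions over the vertices of a facet `I` gives a series over `m ∈ ℤ^I`.
Averaging over `h₂ ∈ H_I` is a character sum that keeps exactly the `m` of the form `(⟨u,v_i⟩)_i`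
with `u ∈ L^*` (`sum_char_eq_zero`, `hasSum_facet`). The coefficient of `t^{-u}` is then a sum over
`h₁ ∈ H_I` of products of factors `1/(1-ζq^{⟨u,v_i⟩}) - ε_i`, where `ε_i = 1` if `f_{I,h₁,i} = 0`
and `Im⟨u_i^I,w⟩ > 0`, and `ε_i = 0` otherwise.

Expanding such a product over faces `J ⊆ I`, the `J`-term retains only the `h₁` coming from `H_J`,
and occurs only if `Im w` has positive coordinates at the vertices of `I` off `J` (`facetCoeff_eq`).
Summed over `I` with weights `w(I)`, these conditions count the cones of `Δ_J` containing the image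
of `Im w`, that is, they give `deg(Δ_J)` (`deg_eq`). Completeness makes this independent of the
chamber of `Im w`. -/

lemma eTwoPi_add (a b : ℂ) : eTwoPi (a + b) = eTwoPi a * eTwoPi b := by
  simp only [eTwoPi, ← Complex.exp_add]; ring_nf

lemma eTwoPi_zero : eTwoPi 0 = 1 := by simp [eTwoPi]

lemma eTwoPi_ne_zero (a : ℂ) : eTwoPi a ≠ 0 := Complex.exp_ne_zero _

lemma eTwoPi_neg (a : ℂ) : eTwoPi (-a) = (eTwoPi a)⁻¹ := by
  simp [eTwoPi, Complex.exp_neg]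

lemma eTwoPi_zsmul (m : ℤ) (a : ℂ) : eTwoPi (m * a) = eTwoPi a ^ m := by
  rw [eTwoPi, eTwoPi, ← Complex.exp_int_mul]; ring_nf

lemma eTwoPi_sum {ι : Type*} (s : Finset ι) (f : ι → ℂ) :
    eTwoPi (∑ i ∈ s, f i) = ∏ i ∈ s, eTwoPi (f i) := by
  simp [eTwoPi, Finset.mul_sum, Complex.exp_sum]

lemma eTwoPi_eq_one_iff (a : ℂ) : eTwoPi a = 1 ↔ ∃ n : ℤ, a = n := by
  rw [eTwoPi, Complex.exp_eq_one_iff]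
  refine exists_congr fun n => ?_
  rw [mul_comm (n : ℂ)]
  exact mul_right_inj' Complex.two_pi_I_ne_zero

lemma eTwoPi_int (n : ℤ) : eTwoPi n = 1 := (eTwoPi_eq_one_iff _).2 ⟨n, rfl⟩

lemma eTwoPi_one : eTwoPi 1 = 1 := by exact_mod_cast eTwoPi_int 1

lemma norm_eTwoPi (a : ℂ) : ‖eTwoPi a‖ = Real.exp (-(2 * Real.pi * a.im)) := by
  rw [eTwoPi, Complex.norm_exp]
  congr 1
  simp [Complex.mul_re, Complex.mul_im]

lemma norm_eTwoPi_lt_one {a : ℂ} (h : 0 < a.im) : ‖eTwoPi a‖ < 1 := by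
  rw [norm_eTwoPi, Real.exp_lt_one_iff, neg_lt_zero]
  positivity

@[fun_prop]
lemma differentiable_eTwoPi : Differentiable ℂ eTwoPi := by
  unfold eTwoPi; fun_prop

lemma eTwoPi_half : eTwoPi (1 / 2) = -1 := by
  rw [eTwoPi, ← Complex.exp_pi_mul_I]; ring_nf

/-- The infinite product `∏_{k ≥ 0} (1 - x q^k)`. -/
noncomputable def qPochInf (q x : ℂ) : ℂ := ∏' k : ℕ, (1 - x * q ^ k)

section qPochInf

variable {q : ℂ}

lemma summable_norm_mul_pow (hq : ‖q‖ < 1) (x : ℂ) : Summable fun k : ℕ => ‖-(x * q ^ k)‖ := by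
  simpa using (summable_geometric_of_lt_one (norm_nonneg _) hq).mul_left ‖x‖

lemma multipliable_qPochInf (hq : ‖q‖ < 1) (x : ℂ) : Multipliable fun k : ℕ => 1 - x * q ^ k := by
  simpa [sub_eq_add_neg] using multipliable_one_add_of_summable (summable_norm_mul_pow hq x)

lemma qPochInf_eq (hq : ‖q‖ < 1) (x : ℂ) : qPochInf q x = (1 - x) * qPochInf q (q * x) := by
  have h : ∀ k : ℕ, 1 - x * q ^ (k + 1) = 1 - q * x * q ^ k := fun k => by ring
  rw [qPochInf, tprod_eq_zero_mul']
  · simp only [pow_zero, mul_one, qPochInf, h]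
  · simpa only [h] using multipliable_qPochInf hq (q * x)

lemma qPochInf_ne_zero (hq : ‖q‖ < 1) {x : ℂ} (hx : ∀ k : ℕ, x * q ^ k ≠ 1) :
    qPochInf q x ≠ 0 := by
  have := tprod_one_add_ne_zero_of_summable (f := fun k : ℕ => -(x * q ^ k))
    (fun k => by rw [← sub_eq_add_neg, sub_ne_zero]; exact (hx k).symm)
    (summable_norm_mul_pow hq x)
  simpa [qPochInf, sub_eq_add_neg] using this

lemma differentiable_qPochInf (hq : ‖q‖ < 1) : Differentiable ℂ (qPochInf q) := by
  intro x
  have h : HasProdLocallyUniformlyOn (fun (k : ℕ) (x : ℂ) => 1 + -(x * q ^ k))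
      (fun x => ∏' k : ℕ, (1 + -(x * q ^ k))) (Metric.ball 0 (‖x‖ + 1)) := by
    refine Summable.hasProdLocallyUniformlyOn_nat_one_add (u := fun k => (‖x‖ + 1) * ‖q‖ ^ k)
      Metric.isOpen_ball ((summable_geometric_of_lt_one (norm_nonneg _) hq).mul_left _)
      (.of_forall fun k y hy => ?_) (fun k => by fun_prop)
    rw [mem_ball_zero_iff] at hy
    rw [norm_neg, norm_mul, norm_pow]
    gcongr
  have hd := h.differentiableOn (.of_forall fun s => by
    simpa [Finset.prod_fn] using DifferentiableOn.finsetProd (fun _ _ => by fun_prop))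
    Metric.isOpen_ball
  have := hd.differentiableAt (Metric.isOpen_ball.mem_nhds (x := x) (by simp))
  simp only [← sub_eq_add_neg] at this
  exact this

end qPochInf

/-! ### The Jacobi form `Φ`: quasi-periodicity and zeros. -/

lemma norm_eTwoPi_tau_lt_one (τ : UpperHalfPlane) : ‖eTwoPi τ‖ < 1 := norm_eTwoPi_lt_one τ.im_pos

lemma eTwoPi_tau_pow_ne_one (τ : UpperHalfPlane) (k : ℕ) : eTwoPi τ * eTwoPi τ ^ k ≠ 1 := by
  intro h
  rw [← pow_succ'] at h
  have := pow_lt_one₀ (norm_nonneg _) (norm_eTwoPi_tau_lt_one τ) k.succ_ne_zero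
  rw [← norm_pow, h, norm_one] at this
  exact lt_irrefl _ this

/-- The prefactor supplies the missing `k = 0` factor `1 - s` of the first product. In this form a
shift by `τ` merely moves one factor between the two products. -/
lemma jacobiPhi_eq (z : ℂ) (τ : UpperHalfPlane) :
    jacobiPhi z τ = -(eTwoPi (-z / 2) * qPochInf (eTwoPi τ) (eTwoPi z) *
      qPochInf (eTwoPi τ) (eTwoPi τ * (eTwoPi z)⁻¹)) / qPochInf (eTwoPi τ) (eTwoPi τ) ^ 2 := by
  have hq := norm_eTwoPi_tau_lt_one τ
  set q := eTwoPi τ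
  have h1 : ∀ x, HasProd (fun k : ℕ => 1 - x * q ^ (k + 1)) (qPochInf q (q * x)) := fun x => by
    have h : ∀ k : ℕ, 1 - x * q ^ (k + 1) = 1 - q * x * q ^ k := fun k => by ring
    simp only [h]
    exact (multipliable_qPochInf hq (q * x)).hasProd
  have h2 : HasProd (fun k : ℕ => (1 - q ^ (k + 1)) ^ 2) (qPochInf q q ^ 2) := by
    have := (h1 1).pow 2
    simpa using this
  have h3 := ((h1 (eTwoPi z)).mul (h1 (eTwoPi z)⁻¹)).div₀ h2 (pow_ne_zero 2
    (qPochInf_ne_zero hq (eTwoPi_tau_pow_ne_one τ)))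
  rw [jacobiPhi, h3.tprod_eq, qPochInf_eq hq (eTwoPi z)]
  have : eTwoPi (z / 2) = eTwoPi z * eTwoPi (-z / 2) := by rw [← eTwoPi_add]; ring_nf
  rw [this]
  ring

section jacobiPhi

variable (τ : UpperHalfPlane)

lemma qPochInf_tau_ne_zero : qPochInf (eTwoPi τ) (eTwoPi τ) ≠ 0 :=
  qPochInf_ne_zero (norm_eTwoPi_tau_lt_one τ) (eTwoPi_tau_pow_ne_one τ)

lemma jacobiPhi_add_one (z : ℂ) : jacobiPhi (z + 1) τ = -jacobiPhi z τ := by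
  have h1 : eTwoPi (z + 1) = eTwoPi z := by rw [eTwoPi_add, eTwoPi_one, mul_one]
  have h2 : eTwoPi ((z + 1) / 2) = -eTwoPi (z / 2) := by
    rw [add_div, eTwoPi_add, eTwoPi_half]; ring
  have h3 : eTwoPi (-(z + 1) / 2) = -eTwoPi (-z / 2) := by
    rw [neg_add, add_div, eTwoPi_add, neg_div 2 (1 : ℂ), eTwoPi_neg, eTwoPi_half]; norm_num
  rw [jacobiPhi, jacobiPhi, h1, h2, h3]
  ring

lemma jacobiPhi_add_tau (z : ℂ) :
    jacobiPhi (z + τ) τ = -(eTwoPi (-τ / 2) * (eTwoPi z)⁻¹) * jacobiPhi z τ := by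
  have hq := norm_eTwoPi_tau_lt_one τ
  have hq0 := eTwoPi_ne_zero τ
  have hz := eTwoPi_ne_zero z
  rw [jacobiPhi_eq, jacobiPhi_eq, qPochInf_eq hq (eTwoPi z),
    show -(z + τ) / 2 = -z / 2 + -τ / 2 by ring, eTwoPi_add, eTwoPi_add,
    show eTwoPi τ * (eTwoPi z * eTwoPi τ)⁻¹ = (eTwoPi z)⁻¹ by field_simp,
    qPochInf_eq hq (eTwoPi z)⁻¹, mul_comm (eTwoPi z) (eTwoPi τ)]
  field_simp
  ring

/-- The factor `Φ(z,τ) / (1 - eTwoPi z)`, which is holomorphic at `0`. -/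
noncomputable def jacobiPhiReg (z : ℂ) : ℂ :=
  -(eTwoPi (-z / 2) * qPochInf (eTwoPi τ) (eTwoPi τ * eTwoPi z) *
      qPochInf (eTwoPi τ) (eTwoPi τ * eTwoPi (-z))) / qPochInf (eTwoPi τ) (eTwoPi τ) ^ 2

lemma jacobiPhi_eq_mul_reg (z : ℂ) : jacobiPhi z τ = (1 - eTwoPi z) * jacobiPhiReg τ z := by
  rw [jacobiPhi_eq, jacobiPhiReg, qPochInf_eq (norm_eTwoPi_tau_lt_one τ) (eTwoPi z), eTwoPi_neg]
  ring

lemma jacobiPhiReg_zero : jacobiPhiReg τ 0 = -1 := by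
  have := qPochInf_tau_ne_zero τ
  simp only [jacobiPhiReg, neg_zero, zero_div, eTwoPi_zero, mul_one, one_mul]
  field_simp

@[fun_prop]
lemma differentiable_jacobiPhiReg : Differentiable ℂ (jacobiPhiReg τ) := by
  have := differentiable_qPochInf (norm_eTwoPi_tau_lt_one τ)
  unfold jacobiPhiReg
  fun_prop

@[fun_prop]
lemma differentiable_jacobiPhi : Differentiable ℂ (fun z => jacobiPhi z τ) := by
  simp only [jacobiPhi_eq_mul_reg]
  fun_prop

lemma jacobiPhi_ne_zero {z : ℂ} (hz : ∀ m : ℤ, eTwoPi z * eTwoPi τ ^ m ≠ 1) :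
    jacobiPhi z τ ≠ 0 := by
  have hq := norm_eTwoPi_tau_lt_one τ
  have hq0 := eTwoPi_ne_zero τ
  have hz0 := eTwoPi_ne_zero z
  rw [jacobiPhi_eq]
  refine div_ne_zero (neg_ne_zero.2 (mul_ne_zero (mul_ne_zero (eTwoPi_ne_zero _)
    (qPochInf_ne_zero hq fun k => by exact_mod_cast hz k))
    (qPochInf_ne_zero hq fun k h => hz (-(k + 1 : ℕ)) ?_))) (pow_ne_zero 2 (qPochInf_tau_ne_zero τ))
  rw [zpow_neg, zpow_natCast, pow_succ']
  field_simp at h ⊢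
  exact h.symm

/-- The `z`-dependent parts of the two automorphy factors cancel in the quotient; only `ζ⁻¹` is
left. -/
lemma ellPhi_add_tau (z σ : ℂ) : ellPhi (z + τ) τ σ = (eTwoPi σ)⁻¹ * ellPhi z τ σ := by
  rw [ellPhi, ellPhi, add_right_comm, jacobiPhi_add_tau, jacobiPhi_add_tau, eTwoPi_add]
  have h1 := eTwoPi_ne_zero z
  have h2 := eTwoPi_ne_zero σ
  have h3 := eTwoPi_ne_zero (-τ / 2)
  generalize eTwoPi (-τ / 2) = c at h3 ⊢
  rw [mul_div_mul_comm]
  congr 1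
  field_simp

lemma ellPhi_add_int_mul_tau (z σ : ℂ) (n : ℤ) :
    ellPhi (z + n * τ) τ σ = eTwoPi σ ^ (-n) * ellPhi z τ σ := by
  have h2 := eTwoPi_ne_zero σ
  induction n using Int.induction_on with
  | zero => simp
  | succ n ih =>
    push_cast at ih ⊢
    rw [add_mul, one_mul, ← add_assoc, ellPhi_add_tau, ih, neg_add, zpow_add₀ h2, zpow_neg_one]
    ring
  | pred n ih =>
    have := ellPhi_add_tau τ (z + (-n - 1) * τ) σ
    push_cast at ih ⊢
    rw [show z + (-n - 1) * (τ : ℂ) + τ = z + -n * τ by ring, ih] at this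
    rw [neg_sub, sub_eq_add_neg (1 : ℤ), zpow_add₀ h2, zpow_one, mul_assoc, this]
    field_simp

end jacobiPhi

/-! ### Lambert and Kronecker series. -/

/-- The series `∑_{k ≥ 0} r^k / (1 - x q^k)`. -/
noncomputable def lambertSum (q r x : ℂ) : ℂ := ∑' k : ℕ, r ^ k / (1 - x * q ^ k)

section lambertSum

variable {q r : ℂ}

lemma summable_lambertSum (hq : ‖q‖ < 1) (hr : ‖r‖ < 1) (x : ℂ) :
    Summable fun k : ℕ => r ^ k / (1 - x * q ^ k) := by
  have h1 : Tendsto (fun k : ℕ => (1 - x * q ^ k)⁻¹) atTop (𝓝 (1 - x * 0)⁻¹) := by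
    refine Tendsto.inv₀ (tendsto_const_nhds.sub ((tendsto_pow_atTop_nhds_zero_of_norm_lt_one
      hq).const_mul x)) (by simp)
  refine summable_of_isBigO_nat (summable_geometric_of_lt_one (norm_nonneg r) hr) ?_
  have h2 : (fun k : ℕ => r ^ k) =O[atTop] fun k => ‖r‖ ^ k :=
    Asymptotics.IsBigO.of_norm_le fun k => by simp
  simpa [div_eq_mul_inv] using h2.mul (h1.isBigO_one ℝ)

lemma lambertSum_eq (hq : ‖q‖ < 1) (hr : ‖r‖ < 1) (x : ℂ) :
    lambertSum q r x = (1 - x)⁻¹ + r * lambertSum q r (q * x) := by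
  rw [lambertSum, (summable_lambertSum hq hr x).tsum_eq_zero_add, lambertSum, ← tsum_mul_left]
  congr 1
  · simp
  · refine tsum_congr fun k => ?_
    rw [pow_succ', pow_succ', mul_div_assoc, mul_comm q x, mul_assoc]

lemma differentiableAt_lambertSum (hq : ‖q‖ < 1) (hr : ‖r‖ < 1) {x : ℂ}
    (hx : ∀ k : ℕ, x * q ^ k ≠ 1) : DifferentiableAt ℂ (lambertSum q r) x := by
  obtain ⟨N, hN⟩ : ∃ N : ℕ, ‖x * q ^ N‖ < 1 := by
    have := ((tendsto_pow_atTop_nhds_zero_of_norm_lt_one hq).const_mul x).norm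
    rw [mul_zero, norm_zero] at this
    exact (this.eventually (gt_mem_nhds one_pos)).exists
  -- For `‖x‖ < 1` the denominators are bounded below near `x` and the Weierstrass test applies.
  -- Otherwise the functional equation replaces `x` by `q x`, and `N` such moves reach the unit
  -- disc.
  induction N generalizing x with
  | zero =>
    rw [pow_zero, mul_one] at hN
    obtain ⟨ρ, h1, h2⟩ := exists_between hN
    have hb : ∀ (k : ℕ) (y : ℂ), y ∈ Metric.ball (0 : ℂ) ρ → 1 - ρ ≤ ‖1 - y * q ^ k‖ := by
      intro k y hy
      rw [mem_ball_zero_iff] at hy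
      have h3 : ‖y * q ^ k‖ ≤ ρ := by
        rw [norm_mul, norm_pow]
        calc ‖y‖ * ‖q‖ ^ k ≤ ρ * 1 := by
              gcongr
              · exact (norm_nonneg x).trans h1.le
              · exact pow_le_one₀ (norm_nonneg _) hq.le
          _ = ρ := mul_one ρ
      have := norm_sub_norm_le (1 : ℂ) (y * q ^ k)
      rw [norm_one] at this
      linarith
    have := differentiableOn_tsum_of_summable_norm (F := fun (k : ℕ) y => r ^ k / (1 - y * q ^ k))
      ((summable_geometric_of_lt_one (norm_nonneg _) hr).div_const (1 - ρ))
      (fun k => DifferentiableOn.div (by fun_prop) (by fun_prop) fun y hy h0 => by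
        have := hb k y hy
        rw [h0, norm_zero] at this
        linarith) Metric.isOpen_ball (fun k y hy => by
        rw [norm_div, norm_pow]
        have := hb k y hy
        have : 0 < 1 - ρ := by linarith
        gcongr)
    exact this.differentiableAt (Metric.isOpen_ball.mem_nhds (by simpa using h1))
  | succ N ih =>
    have h1 : DifferentiableAt ℂ (lambertSum q r) (q * x) :=
      ih (fun k => by rw [mul_comm q, mul_assoc, ← pow_succ']; exact hx _)
        (by rw [mul_comm q, mul_assoc, ← pow_succ']; exact hN)
    have h2 : lambertSum q r = fun x => (1 - x)⁻¹ + r * lambertSum q r (q * x) := by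
      ext x; exact lambertSum_eq hq hr x
    rw [h2]
    have h3 : DifferentiableAt ℂ (fun x => lambertSum q r (q * x)) x :=
      h1.comp x (by fun_prop)
    have h4 : 1 - x ≠ 0 := sub_ne_zero.2 fun h => hx 0 (by simp [← h])
    fun_prop (disch := assumption)

end lambertSum

/-- Kronecker's series `∑_{m ∈ ℤ} s^m / (1 - x q^m)`. -/
noncomputable def kroneckerSum (q s x : ℂ) : ℂ := ∑' m : ℤ, s ^ m / (1 - x * q ^ m)

section kroneckerSum

variable {q s : ℂ}

lemma kroneckerSum_mul (hq : q ≠ 0) (hs : s ≠ 0) (x : ℂ) :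
    kroneckerSum q s (x * q) = s⁻¹ * kroneckerSum q s x := by
  rw [kroneckerSum, kroneckerSum, ← tsum_mul_left, ← (Equiv.addRight (1 : ℤ)).tsum_eq
    (fun m : ℤ => s⁻¹ * (s ^ m / (1 - x * q ^ m)))]
  refine tsum_congr fun m => ?_
  rw [Equiv.coe_addRight, zpow_add₀ hq, zpow_add₀ hs, zpow_one, zpow_one, mul_assoc,
    mul_comm q (q ^ m)]
  field_simp

/-- For negative `m`, pulling `-x q^m` out of the denominator leaves a Lambert series of ratio
`q/s`. This is why `s` must lie in the annulus `‖q‖ < ‖s‖ < 1`. -/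
lemma hasSum_kroneckerSum (hq : ‖q‖ < 1) (hq0 : q ≠ 0) (hqs : ‖q‖ < ‖s‖) (hs : ‖s‖ < 1) {x : ℂ}
    (hx : x ≠ 0) :
    HasSum (fun m : ℤ => s ^ m / (1 - x * q ^ m))
      (lambertSum q s x + -(x⁻¹ * (q / s)) * lambertSum q (q / s) (x⁻¹ * q)) := by
  have hs0 : s ≠ 0 := norm_pos_iff.1 ((norm_nonneg q).trans_lt hqs)
  refine HasSum.of_nat_of_neg_add_one ?_ ?_
  · simp only [zpow_natCast]
    exact (summable_lambertSum hq hs x).hasSum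
  · have hqs' : ‖q / s‖ < 1 := by rwa [norm_div, div_lt_one (norm_pos_iff.2 hs0)]
    refine ((summable_lambertSum hq hqs' (x⁻¹ * q)).hasSum.mul_left
      (-(x⁻¹ * (q / s)))).congr_fun fun k => ?_
    have h1 : 1 - x * q ^ (-((k : ℤ) + 1)) = -(x * (q ^ (k + 1))⁻¹) * (1 - x⁻¹ * q * q ^ k) := by
      rw [show -((k : ℤ) + 1) = -((k + 1 : ℕ) : ℤ) by push_cast; ring, zpow_neg, zpow_natCast]
      field_simp
      ring
    have h2 : s ^ (-((k : ℤ) + 1)) = (s ^ (k + 1))⁻¹ := by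
      rw [show -((k : ℤ) + 1) = -((k + 1 : ℕ) : ℤ) by push_cast; ring, zpow_neg, zpow_natCast]
    rw [h1, h2, div_mul_eq_div_div, mul_div_assoc', div_pow]
    congr 1
    field_simp
    ring

/-- Isolates the pole at `x = 1`: the bracket is holomorphic there. -/
lemma kroneckerSum_eq (hq : ‖q‖ < 1) (hq0 : q ≠ 0) (hqs : ‖q‖ < ‖s‖) (hs : ‖s‖ < 1) {x : ℂ}
    (hx : x ≠ 0) :
    kroneckerSum q s x =
      (1 - x)⁻¹ + (s * lambertSum q s (q * x) -
        x⁻¹ * (q / s) * lambertSum q (q / s) (x⁻¹ * q)) := by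
  rw [kroneckerSum, (hasSum_kroneckerSum hq hq0 hqs hs hx).tsum_eq, lambertSum_eq hq hs x]
  ring

end kroneckerSum
-- Liouville and removable singularities; zeros of `Φ`.
lemma forall_lattice_of_periodic {P : ℂ → Prop} {τ : ℂ} (h0 : P 0) (h1 : ∀ z, P z ↔ P (z + 1))
    (hτ : ∀ z, P z ↔ P (z + τ)) (m n : ℤ) : P (m + n * τ) := by
  have h2 : P m := by
    induction m using Int.induction_on with
    | zero => simpa using h0
    | succ m ih => simpa using (h1 _).1 ih
    | pred m ih => exact (h1 _).2 (by simpa using ih)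
  induction n using Int.induction_on with
  | zero => simpa using h2
  | succ n ih =>
    have := (hτ _).1 ih
    rw [add_assoc, ← add_one_mul] at this
    exact_mod_cast this
  | pred n ih =>
    refine (hτ _).2 ?_
    rw [add_assoc, ← add_one_mul]
    convert ih using 3
    push_cast
    ring

/-- An entire function which is multiplied by `eTwoPi (-z)` under translation by `τ` and is
invariant under translation by `1` vanishes, if `0 < Im z < Im τ`. -/
lemma eq_zero_of_quasiperiodic (τ : UpperHalfPlane) {z : ℂ} (hz0 : 0 < z.im) (hz1 : z.im < τ.im)
    {f : ℂ → ℂ} (hf : Differentiable ℂ f) (h1 : ∀ x, f (x + 1) = f x)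
    (hτ : ∀ x, f (x + τ) = (eTwoPi z)⁻¹ * f x) (x : ℂ) : f x = 0 := by
  have hτ0 := τ.im_pos
  -- With this real exponent `‖e^{2πiaτ}‖ = ‖e^{2πiz}‖`, so the twist makes `‖h‖` doubly periodic
  -- while keeping `h` entire.
  set a : ℝ := z.im / τ.im with ha
  set h : ℂ → ℂ := fun x => f x * eTwoPi (a * x) with hh
  have hd : Differentiable ℂ h := by fun_prop
  have p1 : Function.Periodic (fun x => ‖h x‖) 1 := fun x => by
    simp only [hh, h1, norm_mul, norm_eTwoPi, mul_add, add_im, mul_one, ofReal_im, add_zero]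
  have pτ : Function.Periodic (fun x => ‖h x‖) τ := fun x => by
    simp only [hh, hτ, mul_add, eTwoPi_add, norm_mul, norm_inv]
    have : ‖eTwoPi (a * τ)‖ = ‖eTwoPi z‖ := by
      rw [norm_eTwoPi, norm_eTwoPi, im_ofReal_mul, ha, UpperHalfPlane.coe_im,
        div_mul_cancel₀ _ hτ0.ne']
    rw [this]
    have := norm_ne_zero_iff.2 (eTwoPi_ne_zero z)
    field_simp
  have hb : Bornology.IsBounded (Set.range h) := by
    have hK : IsCompact (Set.Icc (0 : ℝ) 1 ×ℂ Set.Icc (0 : ℝ) τ.im) :=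
      isCompact_Icc.reProdIm isCompact_Icc
    obtain ⟨C, hC⟩ := hK.exists_bound_of_continuousOn hd.continuous.continuousOn
    refine isBounded_iff_forall_norm_le.2 ⟨C, ?_⟩
    rintro _ ⟨x, rfl⟩
    set n := ⌊x.im / τ.im⌋
    set m := ⌊(x - n * τ).re⌋
    have e1 : ‖h x‖ = ‖h (x - n * τ - m)‖ := by
      have e2 := p1.sub_zsmul_eq (x := x - n * τ) m
      have e3 := pτ.sub_zsmul_eq (x := x) n
      simp only [zsmul_eq_mul, mul_one] at e2 e3
      rw [e2, e3]
    rw [e1]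
    have e4 : (x - n * τ - m).re = (x - n * τ).re - m := by simp
    have e5 : (x - n * τ - m).im = x.im - n * τ.im := by simp
    refine hC _ (mem_reProdIm.2 ⟨?_, ?_⟩)
    · rw [e4]
      exact ⟨sub_nonneg.2 (Int.floor_le _), (sub_lt_iff_lt_add'.2 (Int.lt_floor_add_one _)).le⟩
    · rw [e5]
      have h4 := (le_div_iff₀ hτ0).1 (Int.floor_le (x.im / τ.im))
      have h5 := (div_lt_iff₀ hτ0).1 (Int.lt_floor_add_one (x.im / τ.im))
      constructor <;> linarith
  have hc : ∀ x y, h x = h y := hd.apply_eq_apply_of_bounded hb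
  -- Now `h` is constant, but translation by `1` multiplies it by `e^{2πia}`. This factor is not
  -- `1`, because `0 < a < 1`.
  have h0 : h x = 0 := by
    have e1 := hc (x + 1) x
    simp only [hh, h1, mul_add, mul_one, eTwoPi_add] at e1
    by_contra h0
    rw [← mul_assoc] at e1
    have e2 : eTwoPi a = 1 := by
      have : h x * eTwoPi a = h x * 1 := by rw [mul_one]; exact e1
      exact mul_left_cancel₀ h0 this
    obtain ⟨k, hk⟩ := (eTwoPi_eq_one_iff _).1 e2
    have hk' : a = k := by exact_mod_cast hk
    have a0 : 0 < a := by positivity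
    have a1 : a < 1 := (div_lt_one hτ0).2 hz1
    rw [hk'] at a0 a1
    norm_cast at a0 a1
    omega
  exact (mul_eq_zero.1 h0).resolve_right (eTwoPi_ne_zero _)

/-- A function that is holomorphic on a punctured neighbourhood of every point, holomorphic on a
dense open set, with `(z - c) f z → 0` at every `c`, agrees there with an entire function. -/
lemma exists_entire_extension {f : ℂ → ℂ} {U : Set ℂ} (hU : ∀ c, ∀ᶠ z in 𝓝[≠] c, z ∈ U)
    (hf : ∀ z ∈ U, DifferentiableAt ℂ f z)
    (h0 : ∀ c ∉ U, Tendsto (fun z => (z - c) * f z) (𝓝[≠] c) (𝓝 0)) :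
    ∃ F : ℂ → ℂ, Differentiable ℂ F ∧ ∀ z ∈ U, F z = f z := by
  have hFf : ∀ z ∈ U, limUnder (𝓝[≠] z) f = f z := fun z hz =>
    ((hf z hz).continuousAt.tendsto.mono_left nhdsWithin_le_nhds).limUnder_eq
  refine ⟨fun c => limUnder (𝓝[≠] c) f, fun c => ?_, hFf⟩
  obtain ⟨V, hV, hVU⟩ := mem_nhdsWithin_iff_exists_mem_nhds_inter.1 (hU c)
  -- The form of Riemann's criterion needed: `f` grows more slowly than `1/(z - c)`.
  have ho : (fun z => f z - f c) =o[𝓝[≠] c] fun z => (z - c)⁻¹ := by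
    have hne : ∀ᶠ z in 𝓝[≠] c, (z - c)⁻¹ = 0 → f z - f c = 0 := by
      filter_upwards [self_mem_nhdsWithin] with z hz h
      exact absurd h (inv_ne_zero (sub_ne_zero.2 hz))
    rw [Asymptotics.isLittleO_iff_tendsto' hne]
    have h1 : Tendsto (fun z => (z - c) * f z) (𝓝[≠] c) (𝓝 0) := by
      by_cases hc : c ∈ U
      · have : ContinuousAt (fun z => (z - c) * f z) c :=
          (by fun_prop : ContinuousAt (fun z => z - c) c).mul (hf c hc).continuousAt
        have := this.tendsto.mono_left (nhdsWithin_le_nhds (s := {c}ᶜ))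
        simpa using this
      · exact h0 c hc
    have h2 : Tendsto (fun z => (z - c) * f c) (𝓝[≠] c) (𝓝 0) := by
      have : ContinuousAt (fun z => (z - c) * f c) c := by fun_prop
      have := this.tendsto.mono_left (nhdsWithin_le_nhds (s := {c}ᶜ))
      simpa using this
    have h3 := h1.sub h2
    rw [sub_zero] at h3
    refine h3.congr fun z => ?_
    rw [div_inv_eq_mul]; ring
  have hd := (Complex.differentiableOn_update_limUnder_of_isLittleO hV (fun z hz =>
    (hf z (hVU hz)).differentiableWithinAt) ho).differentiableAt hV
  refine hd.congr_of_eventuallyEq ?_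
  have := eventually_nhdsWithin_iff.1 (hU c)
  filter_upwards [this] with z hz
  by_cases hzc : z = c
  · subst hzc; simp
  · rw [Function.update_of_ne hzc]
    exact hFf z (hz hzc)

lemma eTwoPi_mul_zpow (τ : UpperHalfPlane) (z : ℂ) (n : ℤ) :
    eTwoPi z * eTwoPi τ ^ n = eTwoPi (z + n * τ) := by
  rw [eTwoPi_add, eTwoPi_zsmul]

lemma jacobiPhi_ne_zero_iff {z : ℂ} (τ : UpperHalfPlane) :
    jacobiPhi z τ ≠ 0 ↔ ∀ m : ℤ, eTwoPi z * eTwoPi τ ^ m ≠ 1 := by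
  refine ⟨fun h m hm => h ?_, jacobiPhi_ne_zero τ⟩
  rw [eTwoPi_mul_zpow, eTwoPi_eq_one_iff] at hm
  obtain ⟨n, hn⟩ := hm
  have h0 : jacobiPhi 0 τ = 0 := by simp [jacobiPhi_eq_mul_reg, eTwoPi_zero]
  have := forall_lattice_of_periodic (P := fun z => jacobiPhi z τ = 0) (τ := τ) h0
    (fun z => by rw [jacobiPhi_add_one, neg_eq_zero])
    (fun z => by
      rw [jacobiPhi_add_tau, mul_eq_zero_iff_left]
      exact neg_ne_zero.2 (mul_ne_zero (eTwoPi_ne_zero _) (inv_ne_zero (eTwoPi_ne_zero _)))) n (-m)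
  rw [eq_sub_of_add_eq hn]
  convert this using 2
  push_cast
  ring

lemma exists_eq_of_jacobiPhi_eq_zero {z : ℂ} {τ : UpperHalfPlane} (h : jacobiPhi z τ = 0) :
    ∃ m n : ℤ, z = m + n * τ := by
  by_contra! hne
  refine (jacobiPhi_ne_zero_iff τ).2 (fun m hm => ?_) h
  rw [eTwoPi_mul_zpow, eTwoPi_eq_one_iff] at hm
  obtain ⟨n, hn⟩ := hm
  refine hne n (-m) ?_
  rw [eq_sub_of_add_eq hn]
  push_cast
  ring

lemma jacobiPhi_ne_zero_of_im {z : ℂ} {τ : UpperHalfPlane} (hz0 : 0 < z.im) (hz1 : z.im < τ.im) :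
    jacobiPhi z τ ≠ 0 := by
  intro h
  obtain ⟨m, n, rfl⟩ := exists_eq_of_jacobiPhi_eq_zero h
  simp at hz0 hz1
  have hτ := τ.im_pos
  have h0 : (0 : ℝ) < n := pos_of_mul_pos_left hz0 hτ.le
  have h1 : (n : ℝ) < 1 := by
    by_contra! h1
    nlinarith
  norm_cast at h0 h1
  omega

/-- Zeros of an entire function are isolated unless it vanishes identically; the point `i Im τ / 2`
lies in the zero-free strip and excludes the latter. -/
lemma eventually_jacobiPhi_ne_zero (τ : UpperHalfPlane) (c : ℂ) :
    ∀ᶠ z in 𝓝[≠] c, jacobiPhi z τ ≠ 0 := by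
  have ha : AnalyticOnNhd ℂ (fun z => jacobiPhi z τ) Set.univ :=
    (differentiable_jacobiPhi τ).differentiableOn.analyticOnNhd isOpen_univ
  rcases (ha c trivial).eventually_eq_zero_or_eventually_ne_zero with h | h
  · have := ha.eqOn_zero_of_preconnected_of_eventuallyEq_zero isPreconnected_univ trivial h
    have h2 : jacobiPhi (Complex.I * (τ.im / 2)) τ ≠ 0 :=
      jacobiPhi_ne_zero_of_im (by simpa using τ.im_pos) (by simpa using τ.im_pos)
    exact absurd (this trivial) h2
  · exact h

/-! ### Kronecker's identity and the expansion of `φ`. -/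

section kronecker

variable (τ : UpperHalfPlane) {z : ℂ}

/-- `Φ(z+σ)/(Φ(z)Φ(σ)) + ∑_m s^m/(1-ζq^m)`, with `s = eTwoPi z` and `ζ = eTwoPi σ`. -/
noncomputable def kroneckerDefect (z σ : ℂ) : ℂ :=
  jacobiPhi (z + σ) τ / (jacobiPhi z τ * jacobiPhi σ τ) +
    kroneckerSum (eTwoPi τ) (eTwoPi z) (eTwoPi σ)

lemma kroneckerDefect_add_one (z σ : ℂ) :
    kroneckerDefect τ z (σ + 1) = kroneckerDefect τ z σ := by
  rw [kroneckerDefect, kroneckerDefect, ← add_assoc, jacobiPhi_add_one, jacobiPhi_add_one,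
    eTwoPi_add, eTwoPi_one, mul_one, mul_neg, neg_div_neg_eq]

lemma kroneckerDefect_add_tau (z σ : ℂ) :
    kroneckerDefect τ z (σ + τ) = (eTwoPi z)⁻¹ * kroneckerDefect τ z σ := by
  rw [kroneckerDefect, kroneckerDefect, ← add_assoc, jacobiPhi_add_tau, jacobiPhi_add_tau,
    eTwoPi_add, eTwoPi_add, kroneckerSum_mul (eTwoPi_ne_zero τ) (eTwoPi_ne_zero z), mul_add]
  have h1 := eTwoPi_ne_zero z
  have h2 := eTwoPi_ne_zero σ
  have h3 := eTwoPi_ne_zero (-τ / 2)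
  generalize eTwoPi (-τ / 2) = c at h3 ⊢
  congr 1
  rw [mul_left_comm (jacobiPhi z τ), mul_div_mul_comm]
  congr 1
  field_simp

lemma norm_tau_lt_norm (hz1 : z.im < τ.im) : ‖eTwoPi τ‖ < ‖eTwoPi z‖ := by
  rw [norm_eTwoPi, norm_eTwoPi, Real.exp_lt_exp, UpperHalfPlane.coe_im]
  have := Real.pi_pos
  nlinarith

/-- Only `m ≠ 0` is excluded, so that this also applies at `σ = 0`, where the remaining term
`1/(1-ζ)` has its pole. -/
lemma differentiableAt_lambertSum_eTwoPi (hz0 : 0 < z.im) (hz1 : z.im < τ.im) {σ : ℂ}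
    (hσ : ∀ m : ℤ, m ≠ 0 → eTwoPi σ * eTwoPi τ ^ m ≠ 1) :
    DifferentiableAt ℂ (fun σ => eTwoPi z * lambertSum (eTwoPi τ) (eTwoPi z) (eTwoPi τ * eTwoPi σ) -
        (eTwoPi σ)⁻¹ * (eTwoPi τ / eTwoPi z) *
          lambertSum (eTwoPi τ) (eTwoPi τ / eTwoPi z) ((eTwoPi σ)⁻¹ * eTwoPi τ)) σ := by
  have hq := norm_eTwoPi_tau_lt_one τ
  have hs := norm_eTwoPi_lt_one hz0
  have hqs : ‖eTwoPi τ / eTwoPi z‖ < 1 := by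
    rw [norm_div, div_lt_one (norm_pos_iff.2 (eTwoPi_ne_zero z))]
    exact norm_tau_lt_norm τ hz1
  have hq0 := eTwoPi_ne_zero τ
  have hσ0 := eTwoPi_ne_zero σ
  have h1 : DifferentiableAt ℂ
      (fun σ => lambertSum (eTwoPi τ) (eTwoPi z) (eTwoPi τ * eTwoPi σ)) σ := by
    refine DifferentiableAt.comp (g := lambertSum (eTwoPi τ) (eTwoPi z)) σ
      (differentiableAt_lambertSum hq hs fun k h => hσ (k + 1 : ℕ) (by simp; omega) ?_)
      (by fun_prop)
    rw [zpow_natCast, ← h]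
    ring
  have h2 : DifferentiableAt ℂ (fun σ =>
      lambertSum (eTwoPi τ) (eTwoPi τ / eTwoPi z) ((eTwoPi σ)⁻¹ * eTwoPi τ)) σ := by
    refine DifferentiableAt.comp (g := lambertSum (eTwoPi τ) (eTwoPi τ / eTwoPi z)) σ
      (differentiableAt_lambertSum hq hqs fun k h => hσ (-(k + 1 : ℕ)) (by simp; omega) ?_)
      (by fun_prop (disch := assumption))
    rw [zpow_neg, zpow_natCast, pow_succ']
    field_simp at h ⊢
    exact h.symm
  fun_prop (disch := assumption)

lemma kroneckerDefect_eq (hz0 : 0 < z.im) (hz1 : z.im < τ.im) (σ : ℂ) :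
    kroneckerDefect τ z σ = jacobiPhi (z + σ) τ / (jacobiPhi z τ * jacobiPhi σ τ) +
      ((1 - eTwoPi σ)⁻¹ +
        (eTwoPi z * lambertSum (eTwoPi τ) (eTwoPi z) (eTwoPi τ * eTwoPi σ) -
        (eTwoPi σ)⁻¹ * (eTwoPi τ / eTwoPi z) *
          lambertSum (eTwoPi τ) (eTwoPi τ / eTwoPi z) ((eTwoPi σ)⁻¹ * eTwoPi τ))) := by
  rw [kroneckerDefect, kroneckerSum_eq (norm_eTwoPi_tau_lt_one τ) (eTwoPi_ne_zero τ)
    (norm_tau_lt_norm τ hz1) (norm_eTwoPi_lt_one hz0) (eTwoPi_ne_zero σ)]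

lemma differentiableAt_kroneckerDefect (hz0 : 0 < z.im) (hz1 : z.im < τ.im) {σ : ℂ}
    (hσ : jacobiPhi σ τ ≠ 0) : DifferentiableAt ℂ (kroneckerDefect τ z) σ := by
  have h1 := (jacobiPhi_ne_zero_iff τ).1 hσ
  have h2 := differentiableAt_lambertSum_eTwoPi τ hz0 hz1 (fun m _ => h1 m)
  have h3 : 1 - eTwoPi σ ≠ 0 := sub_ne_zero.2 fun h => h1 0 (by simp [← h])
  have h4 : jacobiPhi z τ * jacobiPhi σ τ ≠ 0 := mul_ne_zero (jacobiPhi_ne_zero_of_im hz0 hz1) hσ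
  have h5 : DifferentiableAt ℂ (fun σ => jacobiPhi (z + σ) τ) σ :=
    ((differentiable_jacobiPhi τ).comp (by fun_prop : Differentiable ℂ fun σ => z + σ)) σ
  have h6 := differentiable_jacobiPhi τ σ
  rw [funext (kroneckerDefect_eq τ hz0 hz1)]
  fun_prop (disch := assumption)

lemma tendsto_mul_kroneckerDefect (hz0 : 0 < z.im) (hz1 : z.im < τ.im) :
    Tendsto (fun σ => (σ - 0) * kroneckerDefect τ z σ) (𝓝[≠] 0) (𝓝 0) := by
  have hz := jacobiPhi_ne_zero_of_im hz0 hz1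
  have h2 := differentiableAt_lambertSum_eTwoPi τ hz0 hz1 (σ := 0) (fun m hm h => by
    rw [eTwoPi_zero, one_mul, ← eTwoPi_zsmul, eTwoPi_eq_one_iff] at h
    obtain ⟨n, hn⟩ := h
    have := congrArg Complex.im hn
    simp [hm, τ.im_ne_zero] at this)
  set K := fun σ => eTwoPi z * lambertSum (eTwoPi τ) (eTwoPi z) (eTwoPi τ * eTwoPi σ) -
        (eTwoPi σ)⁻¹ * (eTwoPi τ / eTwoPi z) *
          lambertSum (eTwoPi τ) (eTwoPi τ / eTwoPi z) ((eTwoPi σ)⁻¹ * eTwoPi τ) with hK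
  have hb0 : jacobiPhi z τ * jacobiPhiReg τ 0 ≠ 0 := by
    rw [jacobiPhiReg_zero]; simpa using hz
  have h5 : Differentiable ℂ (fun σ => jacobiPhi (z + σ) τ) :=
    (differentiable_jacobiPhi τ).comp (by fun_prop : Differentiable ℂ fun σ => z + σ)
  -- Both poles at `σ = 0` are collected into this function times `1/(1-ζ)`. Its value at `0` is `-1
  -- + 1 = 0`, since `jacobiPhiReg` is `-1` there: the residues cancel.
  have hN : ContinuousAt (fun σ => jacobiPhi (z + σ) τ / (jacobiPhi z τ * jacobiPhiReg τ σ) + 1)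
      0 := by
    have h6 : ContinuousAt (fun σ => jacobiPhi (z + σ) τ) 0 := h5.continuous.continuousAt
    have h7 : ContinuousAt (jacobiPhiReg τ) 0 :=
      (differentiable_jacobiPhiReg τ).continuous.continuousAt
    fun_prop (disch := assumption)
  have hN0 := hN.tendsto.mono_left (nhdsWithin_le_nhds (s := {0}ᶜ))
  simp only [add_zero, jacobiPhiReg_zero, mul_neg, mul_one, div_neg, div_self hz,
    neg_add_cancel] at hN0
  have hD : Tendsto (fun σ : ℂ => σ * (1 - eTwoPi σ)⁻¹) (𝓝[≠] 0) (𝓝 (-(2 * Real.pi * I))⁻¹) := by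
    have hd : HasDerivAt (fun σ => 1 - eTwoPi σ) (-(2 * Real.pi * I)) 0 := by
      have h := ((((hasDerivAt_id (0 : ℂ)).const_mul (2 * Real.pi * I)).cexp).const_sub 1)
      simpa [eTwoPi] using h
    have := (hasDerivAt_iff_tendsto_slope.1 hd).inv₀ (neg_ne_zero.2 two_pi_I_ne_zero)
    refine this.congr fun σ => ?_
    simp [slope_def_field, eTwoPi_zero, div_eq_mul_inv, mul_comm]
  have hK' : Tendsto (fun σ => σ * K σ) (𝓝[≠] 0) (𝓝 0) := by
    have h6 : ContinuousAt (fun σ => σ * K σ) 0 := continuousAt_id.mul h2.continuousAt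
    simpa using h6.tendsto.mono_left (nhdsWithin_le_nhds (s := {0}ᶜ))
  have := (hD.mul hN0).add hK'
  rw [mul_zero, add_zero] at this
  refine this.congr fun σ => ?_
  rw [kroneckerDefect_eq τ hz0 hz1, jacobiPhi_eq_mul_reg τ σ]
  simp only [hK, sub_zero]
  rw [mul_left_comm (jacobiPhi z τ), div_eq_mul_inv _ ((1 - eTwoPi σ) * _), mul_inv]
  ring

lemma kroneckerDefect_eq_zero (hz0 : 0 < z.im) (hz1 : z.im < τ.im) {σ : ℂ}
    (hσ : jacobiPhi σ τ ≠ 0) : kroneckerDefect τ z σ = 0 := by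
  -- Quasi-periodicity carries the removable singularity at `0` to every lattice point.
  have hshift : ∀ l a : ℂ, a ≠ 0 → (∀ x, kroneckerDefect τ z (x + l) = a * kroneckerDefect τ z x) →
      ∀ c, Tendsto (fun σ => (σ - c) * kroneckerDefect τ z σ) (𝓝[≠] c) (𝓝 0) ↔
        Tendsto (fun σ => (σ - (c + l)) * kroneckerDefect τ z σ) (𝓝[≠] (c + l)) (𝓝 0) := by
    intro l a ha h c
    rw [← Filter.map_add_right_nhdsNE (c := l), Filter.tendsto_map'_iff]
    have : ((fun σ => (σ - (c + l)) * kroneckerDefect τ z σ) ∘ fun x => x + l) =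
        fun σ => a * ((σ - c) * kroneckerDefect τ z σ) := by
      ext x
      simp only [Function.comp, h]
      ring
    rw [this]
    refine ⟨fun h => by simpa using h.const_mul a, fun h => ?_⟩
    have := h.const_mul a⁻¹
    simpa [ha] using this
  obtain ⟨F, hF, hFg⟩ := exists_entire_extension (U := {σ | jacobiPhi σ τ ≠ 0})
    (fun c => eventually_jacobiPhi_ne_zero τ c)
    (fun σ hσ => differentiableAt_kroneckerDefect τ hz0 hz1 hσ) (fun c hc => by
      obtain ⟨m, n, rfl⟩ := exists_eq_of_jacobiPhi_eq_zero (not_not.1 hc)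
      exact forall_lattice_of_periodic (tendsto_mul_kroneckerDefect τ hz0 hz1)
        (hshift 1 1 one_ne_zero fun x => by rw [kroneckerDefect_add_one, one_mul])
        (hshift τ _ (inv_ne_zero (eTwoPi_ne_zero z)) (kroneckerDefect_add_tau τ z)) m n)
  -- The transformation laws hold for the extension on a dense set, hence everywhere by continuity.
  have hdense : Dense {σ | jacobiPhi σ τ ≠ 0} := fun c =>
    mem_closure_iff_frequently.2 ((eventually_jacobiPhi_ne_zero τ c).frequently.filter_mono
      nhdsWithin_le_nhds)
  have hF1 : ∀ x, F (x + 1) = F x := by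
    refine fun x => congrFun (Continuous.ext_on hdense
      (hF.continuous.comp (g := F) (f := fun x => x + 1) (by fun_prop)) hF.continuous
      fun y hy => ?_) x
    have hy' : jacobiPhi (y + 1) τ ≠ 0 := by rw [jacobiPhi_add_one]; exact neg_ne_zero.2 hy
    simp only [Function.comp, hFg _ hy, hFg _ hy', kroneckerDefect_add_one]
  have hFτ : ∀ x, F (x + τ) = (eTwoPi z)⁻¹ * F x := by
    refine fun x => congrFun (Continuous.ext_on hdense
      (hF.continuous.comp (g := F) (f := fun x => x + (τ : ℂ)) (by fun_prop))
      (f := F ∘ fun x => x + (τ : ℂ)) (g := fun x => (eTwoPi z)⁻¹ * F x)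
      (by have := hF.continuous; fun_prop) fun y hy => ?_) x
    have hy' : jacobiPhi (y + τ) τ ≠ 0 := by
      rw [jacobiPhi_add_tau]
      exact mul_ne_zero (neg_ne_zero.2 (mul_ne_zero (eTwoPi_ne_zero _)
        (inv_ne_zero (eTwoPi_ne_zero _)))) hy
    simp only [Function.comp, hFg _ hy, hFg _ hy', kroneckerDefect_add_tau]
  rw [← hFg σ hσ]
  exact eq_zero_of_quasiperiodic τ hz0 hz1 hF hF1 hFτ σ

/-- Kronecker's expansion of `φ(z,τ,σ) = Φ(z+σ,τ)/Φ(z,τ)` for `0 < Im z < Im τ`. -/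
theorem hasSum_ellPhi (hz0 : 0 < z.im) (hz1 : z.im < τ.im) {σ : ℂ}
    (hσ : ∀ m : ℤ, eTwoPi σ * eTwoPi τ ^ m ≠ 1) :
    HasSum (fun m : ℤ => -jacobiPhi σ τ * (eTwoPi (m * z) / (1 - eTwoPi σ * eTwoPi τ ^ m)))
      (ellPhi z τ σ) := by
  have h0 := jacobiPhi_ne_zero τ hσ
  have h1 := kroneckerDefect_eq_zero τ hz0 hz1 h0
  have h2 := (hasSum_kroneckerSum (norm_eTwoPi_tau_lt_one τ) (eTwoPi_ne_zero τ)
    (norm_tau_lt_norm τ hz1) (norm_eTwoPi_lt_one hz0) (eTwoPi_ne_zero σ)).summable.hasSum.mul_left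
      (-jacobiPhi σ τ)
  simp only [← eTwoPi_zsmul _ z] at h2
  have h3 := jacobiPhi_ne_zero_of_im hz0 hz1
  rw [kroneckerDefect, add_eq_zero_iff_eq_neg'] at h1
  simp only [kroneckerSum, ← eTwoPi_zsmul _ z] at h1
  have h4 : ellPhi z τ σ = -jacobiPhi σ τ *
      ∑' m : ℤ, eTwoPi (m * z) / (1 - eTwoPi σ * eTwoPi τ ^ m) := by
    rw [h1, ellPhi]
    field_simp
  rw [h4]
  exact h2

/-- The expansion of `ζ^d φ(-a + τ d, τ, σ)` for `|Im a|` small with respect to the distance of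
`d τ` to the lattice. -/
theorem hasSum_ellPhi_fract {a : ℂ} {d : ℝ} (ha0 : 0 < |a.im|) (ha1 : |a.im| < τ.im)
    (hd : Int.fract d ≠ 0 → |a.im| < Int.fract d * τ.im ∧ |a.im| < (1 - Int.fract d) * τ.im)
    {σ : ℂ} (hσ : ∀ m : ℤ, eTwoPi σ * eTwoPi τ ^ m ≠ 1) :
    HasSum (fun m : ℤ => -jacobiPhi σ τ * (eTwoPi (Int.fract d * σ) * eTwoPi (-(m * a)) *
      eTwoPi (m * Int.fract d * τ) * (1 / (1 - eTwoPi σ * eTwoPi τ ^ m) -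
        if Int.fract d = 0 ∧ 0 < a.im then 1 else 0)))
      (eTwoPi (d * σ) * ellPhi (-a + τ * d) τ σ) := by
  have hτ := τ.im_pos
  have hσ0 := eTwoPi_ne_zero σ
  have h1 : eTwoPi (d * σ) * ellPhi (-a + τ * d) τ σ =
      eTwoPi (Int.fract d * σ) * ellPhi (-a + τ * Int.fract d) τ σ := by
    have e : (d : ℂ) = Int.fract d + ⌊d⌋ := by exact_mod_cast (Int.fract_add_floor d).symm
    rw [show -a + (τ : ℂ) * d = -a + τ * Int.fract d + ⌊d⌋ * τ by rw [e]; ring,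
      ellPhi_add_int_mul_tau, show (d : ℂ) * σ = Int.fract d * σ + ⌊d⌋ * σ by rw [e]; ring,
      eTwoPi_add, eTwoPi_zsmul, zpow_neg]
    have := zpow_ne_zero ⌊d⌋ hσ0
    field_simp
  rw [h1]
  have hf0 := Int.fract_nonneg d
  generalize Int.fract d = f at hd hf0 ⊢
  have him : (-a + τ * f).im = -a.im + f * τ.im := by simp [mul_comm]
  -- In this case `-a` lies below the strip and `-a + τ` inside it. The shift gives coefficients
  -- `ζq^m/(1-ζq^m) = 1/(1-ζq^m) - 1`. In all other cases `-a + τf` is already in the strip.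
  by_cases hc : f = 0 ∧ 0 < a.im
  · obtain ⟨rfl, hy⟩ := hc
    have h2 := (hasSum_ellPhi τ (z := -a + τ) (by simp; linarith [abs_lt.1 ha1])
      (by simpa using hy) hσ).mul_left (eTwoPi σ)
    rw [ellPhi_add_tau, mul_inv_cancel_left₀ hσ0] at h2
    simp only [ofReal_zero, zero_mul, mul_zero, add_zero, eTwoPi_zero, one_mul, mul_one, hy,
      and_self, if_true]
    refine h2.congr_fun fun m => ?_
    have h3 := sub_ne_zero.2 (hσ m).symm
    rw [mul_add, eTwoPi_add, eTwoPi_zsmul m (τ : ℂ), mul_neg]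
    field_simp
    ring
  · rw [if_neg hc]
    have h3 : 0 < (-a + τ * f).im ∧ (-a + τ * f).im < τ.im := by
      rw [him]
      by_cases hf : f = 0
      · have hy : a.im < 0 := lt_of_le_of_ne (not_lt.1 fun h => hc ⟨hf, h⟩) (abs_pos.1 ha0)
        rw [hf]
        rw [abs_of_neg hy] at ha1
        constructor <;> linarith
      · have h4 := hd hf
        have := abs_lt.1 h4.1
        have := abs_lt.1 h4.2
        constructor <;> linarith
    refine ((hasSum_ellPhi τ h3.1 h3.2 hσ).mul_left (eTwoPi (f * σ))).congr_fun fun m => ?_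
    rw [mul_add, eTwoPi_add, mul_neg, mul_right_comm (m : ℂ) f τ, mul_assoc (m : ℂ) τ f]
    ring

end kronecker

end

/-! ### Lattice coordinates, and `H_J` as a subgroup of `H_I`. -/

namespace SimplicialMultiFan.GeneratingVectors

variable {ι L : Type*} [AddCommGroup L] {Δ : SimplicialMultiFan ι L} (V : Δ.GeneratingVectors)

lemma coe_spanBasis (K : Δ.Simplex) (i : K.1) :
    (V.spanBasis K i : ℝ ⊗[ℤ] L) = V.real K.1 i := by
  simp [spanBasis, Basis.span_apply]

lemma sum_coord_smul_real (K : Δ.Simplex) (x : Δ.spanCone K) :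
    ∑ i : K.1, (V.spanBasis K).coord i x • V.real K.1 i = x := by
  conv_rhs => rw [← (V.spanBasis K).sum_repr x]
  simp [coe_spanBasis]

lemma real_mem_spanCone (K : Δ.Simplex) (i : K.1) : V.real K.1 i ∈ Δ.spanCone K := by
  rw [← V.coe_spanBasis]; exact Subtype.coe_prop _

/-- The coordinates on `L_K` with respect to `(v_i)_{i ∈ K}`, extended by zero to all indices. -/
noncomputable def latticeCoord (K : Δ.Simplex) (i : ι) : Δ.latticeOf K →+ ℝ := by
  classical
  exact if hi : i ∈ K.1 then
    AddMonoidHom.mk' (fun x => (V.spanBasis K).coord ⟨i, hi⟩ ⟨(1 : ℝ) ⊗ₜ[ℤ] (x : L), x.2⟩)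
      (fun x y => by
        rw [← map_add]
        congr 1
        exact Subtype.ext (TensorProduct.tmul_add _ _ _))
    else 0

lemma latticeCoord_of_mem (K : Δ.Simplex) {i : ι} (hi : i ∈ K.1) (x : Δ.latticeOf K) :
    V.latticeCoord K i x = (V.spanBasis K).coord ⟨i, hi⟩ ⟨(1 : ℝ) ⊗ₜ[ℤ] (x : L), x.2⟩ := by
  simp [latticeCoord, hi]

lemma latticeCoord_of_notMem (K : Δ.Simplex) {i : ι} (hi : i ∉ K.1) (x : Δ.latticeOf K) :
    V.latticeCoord K i x = 0 := by
  simp [latticeCoord, hi]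

lemma sum_latticeCoord_smul (K : Δ.Simplex) (x : Δ.latticeOf K) :
    ∑ i ∈ K.1, V.latticeCoord K i x • ((1 : ℝ) ⊗ₜ[ℤ] V.vec i) = (1 : ℝ) ⊗ₜ[ℤ] (x : L) := by
  rw [← Finset.sum_coe_sort]
  refine Eq.trans ?_ (V.sum_coord_smul_real K ⟨(1 : ℝ) ⊗ₜ[ℤ] (x : L), x.2⟩)
  exact Finset.sum_congr rfl fun i _ => by rw [V.latticeCoord_of_mem K i.2]; rfl

lemma coord_eq_of_sum_eq (K : Δ.Simplex) (x : Δ.spanCone K) (a : ι → ℝ)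
    (h : (x : ℝ ⊗[ℤ] L) = ∑ i ∈ K.1, a i • ((1 : ℝ) ⊗ₜ[ℤ] V.vec i)) (i : K.1) :
    (V.spanBasis K).coord i x = a i := by
  have : x = ∑ i : K.1, a i • V.spanBasis K i := by
    apply Subtype.ext
    rw [h, ← Finset.sum_coe_sort]
    simp [coe_spanBasis, real]
  rw [this, Basis.coord_apply, Basis.repr_sum_self]

lemma latticeCoord_eq_of_sum_eq (K : Δ.Simplex) (x : Δ.latticeOf K) (a : ι → ℝ)
    (h : (1 : ℝ) ⊗ₜ[ℤ] (x : L) = ∑ i ∈ K.1, a i • ((1 : ℝ) ⊗ₜ[ℤ] V.vec i)) {i : ι}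
    (hi : i ∈ K.1) : V.latticeCoord K i x = a i := by
  rw [V.latticeCoord_of_mem K hi]
  exact V.coord_eq_of_sum_eq K ⟨_, x.2⟩ a h ⟨i, hi⟩

lemma tmul_one_injective [Module.Free ℤ L] :
    Function.Injective fun x : L => (1 : ℝ) ⊗ₜ[ℤ] x := by
  intro x y h
  let b := Module.Free.chooseBasis ℤ L
  refine b.repr.injective (Finsupp.ext fun i => ?_)
  have := congrArg (fun z => (b.baseChange ℝ).repr z i) h
  simpa using this

lemma tmul_sum_zsmul (s : Finset ι) (m : ι → ℤ) :
    (1 : ℝ) ⊗ₜ[ℤ] (∑ i ∈ s, m i • V.vec i) = ∑ i ∈ s, (m i : ℝ) • ((1 : ℝ) ⊗ₜ[ℤ] V.vec i) := by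
  rw [TensorProduct.tmul_sum]
  exact Finset.sum_congr rfl fun i _ => by rw [TensorProduct.tmul_smul, Int.cast_smul_eq_zsmul]

lemma mem_sublattice_iff_exists (s : Finset ι) (x : L) :
    x ∈ V.sublattice s ↔ ∃ m : ι → ℤ, x = ∑ i ∈ s, m i • V.vec i := by
  rw [sublattice, Submodule.mem_span_image_finset_iff_exists_fun]
  constructor
  · rintro ⟨m, rfl⟩
    classical
    refine ⟨fun i => if hi : i ∈ s then m ⟨i, hi⟩ else 0, ?_⟩
    rw [← Finset.sum_coe_sort s]
    simp
  · rintro ⟨m, rfl⟩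
    exact ⟨fun i => m i, Finset.sum_coe_sort s fun i => m i • V.vec i⟩

lemma mem_sublattice_iff [Module.Free ℤ L] (K : Δ.Simplex) (x : Δ.latticeOf K) :
    (x : L) ∈ V.sublattice K.1 ↔ ∀ i, ∃ m : ℤ, V.latticeCoord K i x = m := by
  rw [V.mem_sublattice_iff_exists]
  constructor
  · rintro ⟨m, hm⟩ i
    by_cases hi : i ∈ K.1
    · refine ⟨m i, V.latticeCoord_eq_of_sum_eq K x (fun i => m i) ?_ hi⟩
      rw [hm, V.tmul_sum_zsmul]
    · exact ⟨0, by rw [V.latticeCoord_of_notMem K hi, Int.cast_zero]⟩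
  · intro h
    choose m hm using h
    refine ⟨m, tmul_one_injective ?_⟩
    simp only
    rw [V.tmul_sum_zsmul, ← V.sum_latticeCoord_smul K x]
    simp only [hm]

lemma rep_mk_sub_mem (K : Δ.Simplex) (x : Δ.latticeOf K) :
    ((V.rep (Submodule.Quotient.mk x : V.H K) - x : Δ.latticeOf K) : L) ∈ V.sublattice K.1 := by
  have : (Submodule.Quotient.mk (V.rep (Submodule.Quotient.mk x : V.H K)) : V.H K) =
    Submodule.Quotient.mk x := Quotient.out_eq _
  exact (Submodule.Quotient.eq ((V.sublattice K.1).submoduleOf (Δ.latticeOf K))).1 this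

lemma mk_rep (K : Δ.Simplex) (h : V.H K) : Submodule.Quotient.mk (V.rep h) = h := Quotient.out_eq _

/-- The numbers `f_{K,h,i}`, extended by zero to all indices. -/
noncomputable def fExt (K : Δ.Simplex) (h : V.H K) (i : ι) : ℝ :=
  Int.fract (V.latticeCoord K i (V.rep h))

lemma fExt_coe (K : Δ.Simplex) (h : V.H K) (i : K.1) : V.fExt K h i = V.f K h i := by
  rw [fExt, V.latticeCoord_of_mem K i.2, f]

lemma fSum_eq (K : Δ.Simplex) (h : V.H K) : V.fSum K h = ∑ i ∈ K.1, V.fExt K h i := by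
  rw [fSum, ← Finset.sum_coe_sort K.1]
  exact Finset.sum_congr rfl fun i _ => (V.fExt_coe K h i).symm

lemma vSum_eq (K : Δ.Simplex) (h : V.H K) :
    V.vSum K h = ∑ i ∈ K.1, V.fExt K h i • ((1 : ℝ) ⊗ₜ[ℤ] V.vec i) := by
  rw [vSum, ← Finset.sum_coe_sort K.1]
  exact Finset.sum_congr rfl fun i _ => by rw [V.fExt_coe K h i, real]

lemma fExt_of_notMem (K : Δ.Simplex) (h : V.H K) {i : ι} (hi : i ∉ K.1) : V.fExt K h i = 0 := by
  rw [fExt, V.latticeCoord_of_notMem K hi, Int.fract_zero]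

/-- An expansion in the `v_i`, `i ∈ J`, padded by zeros, is the expansion in the basis of `I`. -/
lemma latticeCoord_facet_of_subset {I : Δ.Facet} {J : Δ.Simplex} (hJI : J.1 ⊆ I.1)
    (x : Δ.latticeOf J) (y : Δ.latticeOf I.toSimplex)
    (hxy : (x : L) = y) (i : ι) : V.latticeCoord I.toSimplex i y = V.latticeCoord J i x := by
  by_cases hi : i ∈ I.1
  · refine V.latticeCoord_eq_of_sum_eq I.toSimplex y (fun i => V.latticeCoord J i x) ?_ hi
    rw [← hxy, ← V.sum_latticeCoord_smul J x]
    exact Finset.sum_subset hJI fun i _ hi => by rw [V.latticeCoord_of_notMem J hi, zero_smul]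
  · rw [V.latticeCoord_of_notMem _ hi, V.latticeCoord_of_notMem _ fun h => hi (hJI h)]

variable [Module.Free ℤ L]

lemma fExt_mk (K : Δ.Simplex) (x : Δ.latticeOf K) (i : ι) :
    V.fExt K (Submodule.Quotient.mk x) i = Int.fract (V.latticeCoord K i x) := by
  obtain ⟨m, hm⟩ := (V.mem_sublattice_iff K _).1 (V.rep_mk_sub_mem K x) i
  rw [fExt, Int.fract_eq_fract]
  exact ⟨m, by rw [← hm, map_sub]⟩

variable [Module.Finite ℤ L]

lemma spanCone_facet (I : Δ.Facet) : Δ.spanCone I.toSimplex = ⊤ := by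
  apply Submodule.eq_top_of_finrank_eq
  rw [Module.finrank_baseChange, ← (Finset.mem_filter.1 I.2).2]
  exact Δ.finrank_cone I.1 I.toSimplex.2

lemma latticeOf_facet (I : Δ.Facet) : Δ.latticeOf I.toSimplex = ⊤ := by
  refine eq_top_iff.2 fun x _ => ?_
  change _ ∈ Δ.spanCone I.toSimplex
  rw [spanCone_facet]
  trivial

lemma facetBasis_apply (I : Δ.Facet) (i : I.1) :
    V.facetBasis I i = (1 : ℝ) ⊗ₜ[ℤ] V.vec i := by
  exact Basis.mk_apply (V.linearIndependent I.toSimplex) _ i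

lemma sum_dualVec_smul (I : Δ.Facet) (x : ℝ ⊗[ℤ] L) :
    ∑ i : I.1, V.dualVec I i x • ((1 : ℝ) ⊗ₜ[ℤ] V.vec i) = x := by
  conv_rhs => rw [← (V.facetBasis I).sum_repr x]
  simp only [facetBasis_apply]
  rfl

lemma dualVec_eq_of_sum_eq (I : Δ.Facet) (x : ℝ ⊗[ℤ] L) (a : I.1 → ℝ)
    (h : x = ∑ i : I.1, a i • ((1 : ℝ) ⊗ₜ[ℤ] V.vec i)) (i : I.1) : V.dualVec I i x = a i := by
  simp only [← V.facetBasis_apply] at h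
  rw [h, dualVec, Basis.coord_apply, Basis.repr_sum_self]

lemma dualVec_vec [DecidableEq ι] (I : Δ.Facet) (i j : I.1) :
    V.dualVec I i ((1 : ℝ) ⊗ₜ[ℤ] V.vec j) = if j = i then 1 else 0 := by
  rw [← V.facetBasis_apply, dualVec, Basis.coord_apply, Basis.repr_self, Finsupp.single_apply]

lemma latticeCoord_facet (I : Δ.Facet) (i : I.1) (x : Δ.latticeOf I.toSimplex) :
    V.latticeCoord I.toSimplex i x = V.dualVec I i ((1 : ℝ) ⊗ₜ[ℤ] (x : L)) := by
  refine (V.dualVec_eq_of_sum_eq I _ (fun i => V.latticeCoord I.toSimplex i x) ?_ i).symm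
  rw [← V.sum_latticeCoord_smul I.toSimplex x, ← Finset.sum_coe_sort]
  rfl

lemma f_facet (I : Δ.Facet) (h : V.H I.toSimplex) (i : I.1) :
    V.f I.toSimplex h i = Int.fract (V.dualVec I i ((1 : ℝ) ⊗ₜ[ℤ] (V.rep h : L))) := by
  rw [← V.latticeCoord_facet]
  exact (V.fExt_coe I.toSimplex h i).symm

/-- The class in `H_I` of the representative of a class in `H_J`, for `J ⊆ I`. -/
noncomputable def toFacetH (I : Δ.Facet) (J : Δ.Simplex) (h : V.H J) : V.H I.toSimplex :=
  Submodule.Quotient.mk ⟨V.rep h, by rw [latticeOf_facet]; trivial⟩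

variable {I : Δ.Facet} {J : Δ.Simplex}

lemma fExt_toFacetH (hJI : J.1 ⊆ I.1) (h : V.H J) (i : ι) :
    V.fExt I.toSimplex (V.toFacetH I J h) i = V.fExt J h i := by
  rw [toFacetH, fExt_mk, V.latticeCoord_facet_of_subset hJI (V.rep h) _ rfl, fExt]

/-- Integrality of coordinates does not depend on whether they are taken in `J` or in `I`, so `L_J ∩
L_{I,𝒱} = L_{J,𝒱}`. -/
lemma toFacetH_injective (hJI : J.1 ⊆ I.1) : Function.Injective (V.toFacetH I J) := by
  intro h h' hh
  have h1 : ((⟨V.rep h, by rw [latticeOf_facet]; trivial⟩ -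
      ⟨V.rep h', by rw [latticeOf_facet]; trivial⟩ : Δ.latticeOf I.toSimplex) : L) ∈
      V.sublattice I.toSimplex.1 := (Submodule.Quotient.eq ((V.sublattice I.toSimplex.1).submoduleOf
        (Δ.latticeOf I.toSimplex))).1 hh
  rw [← V.mk_rep J h, ← V.mk_rep J h', Submodule.Quotient.eq]
  refine (V.mem_sublattice_iff J (V.rep h - V.rep h')).2 fun i => ?_
  obtain ⟨m, hm⟩ := (V.mem_sublattice_iff I.toSimplex _).1 h1 i
  exact ⟨m, by rw [← hm]; exact (V.latticeCoord_facet_of_subset hJI _ _ rfl i).symm⟩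

lemma exists_toFacetH_eq (hJI : J.1 ⊆ I.1) (h : V.H I.toSimplex)
    (hf : ∀ i ∈ I.1, i ∉ J.1 → V.fExt I.toSimplex h i = 0) : ∃ h', V.toFacetH I J h' = h := by
  classical
  have h1 : ∀ i, ∃ m : ℤ, i ∉ J.1 → V.latticeCoord I.toSimplex i (V.rep h) = m := fun i => by
    by_cases hi : i ∈ J.1
    · exact ⟨0, fun h => absurd hi h⟩
    · by_cases hi' : i ∈ I.1
      · obtain ⟨m, hm⟩ := Int.fract_eq_zero_iff.1 (hf i hi' hi)
        exact ⟨m, fun _ => hm.symm⟩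
      · exact ⟨0, fun _ => by rw [V.latticeCoord_of_notMem _ hi', Int.cast_zero]⟩
  choose m hm using h1
  -- Off `J` the coordinates are integers `m i`; removing them changes the representative by an
  -- element of `L_{I,𝒱}` and puts it in `L_J`.
  set x : L := V.rep h - ∑ i ∈ I.1 \ J.1, m i • V.vec i with hx
  have hx1 : (1 : ℝ) ⊗ₜ[ℤ] x =
      ∑ i ∈ J.1, V.latticeCoord I.toSimplex i (V.rep h) • ((1 : ℝ) ⊗ₜ[ℤ] V.vec i) := by
    rw [hx, TensorProduct.tmul_sub, V.tmul_sum_zsmul, ← V.sum_latticeCoord_smul I.toSimplex,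
      sub_eq_iff_eq_add]
    change ∑ i ∈ I.1, _ = _
    rw [← Finset.sum_sdiff hJI, add_comm]
    congr 1
    exact Finset.sum_congr rfl fun i hi => by rw [hm i (Finset.mem_sdiff.1 hi).2]
  have hxJ : x ∈ Δ.latticeOf J := by
    change (1 : ℝ) ⊗ₜ[ℤ] x ∈ Δ.spanCone J
    rw [hx1]
    exact Submodule.sum_mem _ fun i hi => Submodule.smul_mem _ _ (V.real_mem_spanCone J ⟨i, hi⟩)
  refine ⟨Submodule.Quotient.mk ⟨x, hxJ⟩, ?_⟩
  conv_rhs => rw [← V.mk_rep _ h]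
  rw [toFacetH, Submodule.Quotient.eq]
  change (V.rep (Submodule.Quotient.mk ⟨x, hxJ⟩ : V.H J) : L) - V.rep h ∈ V.sublattice I.1
  have h2 : (V.rep (Submodule.Quotient.mk ⟨x, hxJ⟩ : V.H J) : L) - x ∈ V.sublattice I.1 :=
    Submodule.span_mono (Set.image_mono (by exact_mod_cast hJI)) (V.rep_mk_sub_mem J ⟨x, hxJ⟩)
  have h3 : x - V.rep h ∈ V.sublattice I.1 := by
    rw [hx, sub_sub_cancel_left]
    exact Submodule.neg_mem _ (Submodule.sum_mem _ fun i hi => Submodule.smul_mem _ _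
      (Submodule.subset_span ⟨i, (Finset.mem_sdiff.1 hi).1, rfl⟩))
  simpa using Submodule.add_mem _ h2 h3

/-- A sum over the `h ∈ H_I` whose coordinates off `J` vanish is a sum over `H_J`. -/
lemma sum_H_facet (hJI : J.1 ⊆ I.1) (F : (ι → ℝ) → ℂ) [DecidablePred fun h : V.H I.toSimplex =>
      ∀ i ∈ I.1, i ∉ J.1 → V.fExt I.toSimplex h i = 0] :
    ∑ h : V.H I.toSimplex with ∀ i ∈ I.1, i ∉ J.1 → V.fExt I.toSimplex h i = 0,
      F (V.fExt I.toSimplex h) = ∑ h : V.H J, F (V.fExt J h) := by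
  refine (Finset.sum_bij (fun h _ => V.toFacetH I J h) (fun h _ => ?_)
    (fun h _ h' _ hh => V.toFacetH_injective hJI hh) (fun h hh => ?_) (fun h _ => ?_)).symm
  · simp only [Finset.mem_filter, Finset.mem_univ, true_and, V.fExt_toFacetH hJI]
    exact fun i _ hi => V.fExt_of_notMem J h hi
  · obtain ⟨h', hh'⟩ := V.exists_toFacetH_eq hJI h (Finset.mem_filter.1 hh).2
    exact ⟨h', Finset.mem_univ _, hh'⟩
  · rw [funext (V.fExt_toFacetH hJI h)]

end SimplicialMultiFan.GeneratingVectors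

/-! ### Projected cones and degrees. -/

namespace SimplicialMultiFan.GeneratingVectors

open Filter Topology

variable {ι L : Type*} [AddCommGroup L] {Δ : SimplicialMultiFan ι L} (V : Δ.GeneratingVectors)

lemma cone_vertex_eq (K : Δ.Simplex) {i : ι} (hi : i ∈ K.1) :
    Δ.cone {i} = PointedCone.hull ℝ {(1 : ℝ) ⊗ₜ[ℤ] V.vec i} :=
  V.cone_eq_hull i (Δ.down_closed K.1 K.2 _ (by simpa using hi))

lemma smul_vec_mem_cone (K : Δ.Simplex) {i : ι} (hi : i ∈ K.1) {a : ℝ} (ha : 0 ≤ a) :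
    a • ((1 : ℝ) ⊗ₜ[ℤ] V.vec i) ∈ Δ.cone K.1 := by
  refine Submodule.smul_mem (Δ.cone K.1) (⟨a, ha⟩ : {c : ℝ // 0 ≤ c}) ?_
  rw [Δ.cone_eq K.1 K.2]
  have hle : Δ.cone {i} ≤ ⨆ j ∈ K.1, Δ.cone {j} :=
    le_iSup₂_of_le (f := fun (j : ι) (_ : j ∈ K.1) => Δ.cone {j}) i hi le_rfl
  refine hle ?_
  rw [V.cone_vertex_eq K hi]
  exact Submodule.subset_span rfl

lemma spanCone_mono {K J : Δ.Simplex} (h : K.1 ⊆ J.1) : Δ.spanCone K ≤ Δ.spanCone J := by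
  refine Submodule.span_mono ?_
  rw [Δ.cone_eq K.1 K.2, Δ.cone_eq J.1 J.2]
  exact SetLike.coe_subset_coe.2 (iSup₂_mono' fun i hi => ⟨i, h hi, le_rfl⟩)

lemma mem_spanCone_of_mkQ_mem {K J : Δ.Simplex} (h : K.1 ⊆ J.1) {x : ℝ ⊗[ℤ] L}
    (hx : (Δ.spanCone K).mkQ x ∈
      Submodule.span ℝ (Δ.projCone K J : Set ((ℝ ⊗[ℤ] L) ⧸ Δ.spanCone K))) :
    x ∈ Δ.spanCone J := by
  have h1 : Submodule.span ℝ (Δ.projCone K J : Set ((ℝ ⊗[ℤ] L) ⧸ Δ.spanCone K)) ≤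
      (Δ.spanCone J).map (Δ.spanCone K).mkQ := by
    refine Submodule.span_le.2 ?_
    rintro _ ⟨y, hy, rfl⟩
    exact ⟨y, Submodule.subset_span hy, rfl⟩
  obtain ⟨y, hy, hyx⟩ := h1 hx
  have h2 : y - x ∈ Δ.spanCone K := (Submodule.Quotient.eq _).1 hyx
  simpa using Submodule.sub_mem _ hy (spanCone_mono h h2)

lemma baseChange_vSum (u : Dual ℤ L) (J : Δ.Simplex) (h : V.H J) :
    u.baseChange ℝ (V.vSum J h) = ∑ i ∈ J.1, V.fExt J h i * u (V.vec i) := by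
  rw [vSum_eq, map_sum]
  exact Finset.sum_congr rfl fun i _ => by simp

/-- The exponential factor of `h`, as a function of its coordinates. -/
noncomputable def expFactor (τ : UpperHalfPlane) (σ : ℂ) (u : Dual ℤ L) (I : Finset ι)
    (a : ι → ℝ) : ℂ :=
  eTwoPi ((∑ i ∈ I, a i : ℝ) * σ) * eTwoPi ((∑ i ∈ I, a i * u (V.vec i) : ℝ) * τ)

lemma expFactor_fExt (τ : UpperHalfPlane) (σ : ℂ) (u : Dual ℤ L) {I : Finset ι}
    {J : Δ.Simplex} (hJI : J.1 ⊆ I) (h : V.H J) :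
    V.expFactor τ σ u I (V.fExt J h) = eTwoPi (V.fSum J h * σ) *
      eTwoPi ((u.baseChange ℝ (V.vSum J h) : ℝ) * τ) := by
  rw [expFactor, fSum_eq, baseChange_vSum]
  rw [Finset.sum_subset hJI fun i _ hi => V.fExt_of_notMem J h hi,
    Finset.sum_subset hJI (f := fun i => V.fExt J h i * u (V.vec i))
      fun i _ hi => by rw [V.fExt_of_notMem J h hi, zero_mul]]

lemma sum_powerset_facet [DecidableEq ι] (I : Δ.Facet) (g : Finset ι → ℂ) :
    ∑ t ∈ I.1.powerset, g t = ∑ J : Δ.Simplex, if J.1 ⊆ I.1 then g J.1 else 0 := by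
  rw [Finset.sum_coe_sort Δ.faces (fun J => if J ⊆ I.1 then g J else 0), ← Finset.sum_filter]
  refine Finset.sum_congr (Finset.ext fun t => ?_) fun _ _ => rfl
  rw [Finset.mem_powerset, Finset.mem_filter]
  exact ⟨fun h => ⟨Δ.down_closed I.1 I.toSimplex.2 t h, h⟩, fun h => h.2⟩

variable [Module.Free ℤ L] [Module.Finite ℤ L]

lemma dualVec_eq_zero_of_mem_spanCone {I : Δ.Facet} {K : Δ.Simplex} (hKI : K.1 ⊆ I.1)
    {x : ℝ ⊗[ℤ] L} (hx : x ∈ Δ.spanCone K) {i : I.1} (hi : i.1 ∉ K.1) : V.dualVec I i x = 0 := by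
  classical
  have h1 : Δ.spanCone K ≤ LinearMap.ker (V.dualVec I i) := by
    rw [V.spanCone_eq K, Submodule.span_le]
    rintro _ ⟨j, rfl⟩
    change V.dualVec I i ((1 : ℝ) ⊗ₜ[ℤ] V.vec j.1) = 0
    rw [V.dualVec_vec I i ⟨j, hKI j.2⟩, if_neg]
    rintro rfl
    exact hi j.2
  exact h1 hx

lemma dualVec_nonneg_of_mem_cone {I : Δ.Facet} {x : ℝ ⊗[ℤ] L} (hx : x ∈ Δ.cone I.1) (i : I.1) :
    0 ≤ V.dualVec I i x := by
  classical
  have h1 : Δ.cone I.1 ≤ (PointedCone.positive ℝ ℝ).comap (V.dualVec I i) := by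
    have h2 := Δ.cone_eq I.1 I.toSimplex.2
    rw [h2]
    refine iSup₂_le fun j hj => ?_
    rw [V.cone_vertex_eq I.toSimplex hj]
    refine Submodule.span_le.2 ?_
    rintro _ rfl
    change 0 ≤ V.dualVec I i ((1 : ℝ) ⊗ₜ[ℤ] V.vec j)
    rw [V.dualVec_vec I i ⟨j, hj⟩]
    split_ifs <;> simp
  exact h1 hx

/-- Modulo the span of `C(K)` the coordinates at the vertices of `K` are free, so only the signs of
the others matter. -/
lemma mkQ_mem_projCone_iff {I : Δ.Facet} {K : Δ.Simplex} (hKI : K.1 ⊆ I.1) (y : ℝ ⊗[ℤ] L) :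
    (Δ.spanCone K).mkQ y ∈ Δ.projCone K I.toSimplex ↔
      ∀ i : I.1, i.1 ∉ K.1 → 0 ≤ V.dualVec I i y := by
  classical
  constructor
  · rintro ⟨c, hc, hcy⟩ i hi
    have h1 : c - y ∈ Δ.spanCone K := (Submodule.Quotient.eq _).1 hcy
    have h2 := V.dualVec_eq_zero_of_mem_spanCone hKI h1 hi
    rw [map_sub, sub_eq_zero] at h2
    rw [← h2]
    exact V.dualVec_nonneg_of_mem_cone hc i
  · intro h
    refine ⟨∑ i : I.1, (if i.1 ∈ K.1 then 0 else V.dualVec I i y) • ((1 : ℝ) ⊗ₜ[ℤ] V.vec i),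
      Submodule.sum_mem _ fun i _ => V.smul_vec_mem_cone I.toSimplex i.2 ?_,
      (Submodule.Quotient.eq _).2 ?_⟩
    · split_ifs with hi
      · exact le_rfl
      · exact h i hi
    · have hsub := congrArg (fun z => (∑ i : I.1, (if i.1 ∈ K.1 then 0 else V.dualVec I i y) •
        ((1 : ℝ) ⊗ₜ[ℤ] V.vec i)) - z) (V.sum_dualVec_smul I y)
      simp only [← Finset.sum_sub_distrib] at hsub
      rw [← hsub]
      refine Submodule.sum_mem _ fun i _ => ?_
      rw [← sub_smul]
      by_cases hi : i.1 ∈ K.1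
      · exact Submodule.smul_mem _ _ (V.real_mem_spanCone K ⟨i, hi⟩)
      · simp [hi]

/-- A vector on no wall of a facet can be moved off the spans of all lower-dimensional cones without
crossing a wall. -/
lemma exists_generic (y : ℝ ⊗[ℤ] L) (hy : ∀ (I : Δ.Facet) (i : I.1), V.dualVec I i y ≠ 0) :
    ∃ y' : ℝ ⊗[ℤ] L, (∀ (I : Δ.Facet) (i : I.1), 0 ≤ V.dualVec I i y' ↔ 0 < V.dualVec I i y) ∧
      ∀ J : Δ.Simplex, J.1.card < finrank ℤ L → y' ∉ Δ.spanCone J := by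
  classical
  -- A real vector space is not a finite union of proper subspaces.
  obtain ⟨d, hd⟩ : ∃ d : ℝ ⊗[ℤ] L,
      ∀ J : Δ.Simplex, J.1.card < finrank ℤ L → d ∉ Δ.spanCone J := by
    have h := Subspace.biUnion_ne_univ_of_top_notMem
      (s := (Finset.univ.filter fun J : Δ.Simplex => J.1.card < finrank ℤ L).image Δ.spanCone) (by
        simp only [Finset.mem_image, Finset.mem_filter, Finset.mem_univ, true_and, not_exists,
          not_and]
        intro J hJ htop
        have := Δ.finrank_cone J.1 J.2
        change finrank ℝ (Δ.spanCone J) = _ at this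
        rw [htop, finrank_top, Module.finrank_baseChange] at this
        omega)
    obtain ⟨d, hd⟩ := (Set.ne_univ_iff_exists_notMem _).1 h
    refine ⟨d, fun J hJ hdJ => hd ?_⟩
    simp only [Set.mem_iUnion]
    exact ⟨_, Finset.mem_image_of_mem _ (by simpa using hJ), hdJ⟩
  have h1 : ∀ᶠ ε : ℝ in 𝓝[≠] 0, ∀ (I : Δ.Facet) (i : I.1),
      0 ≤ V.dualVec I i (y + ε • d) ↔ 0 < V.dualVec I i y := by
    refine eventually_all.2 fun I => eventually_all.2 fun i => nhdsWithin_le_nhds ?_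
    have hc : ContinuousAt (fun ε : ℝ => V.dualVec I i (y + ε • d)) 0 := by
      simp only [map_add, map_smul]
      fun_prop
    rcases lt_or_gt_of_ne (hy I i) with h | h
    · have := hc.eventually_lt (continuousAt_const (y := 0)) (by simpa using h)
      filter_upwards [this] with ε hε
      exact iff_of_false hε.not_ge h.not_gt
    · have := (continuousAt_const (y := 0)).eventually_lt hc (by simpa using h)
      filter_upwards [this] with ε hε
      exact iff_of_true hε.le h
  have h2 : ∀ᶠ ε : ℝ in 𝓝[≠] 0, ∀ J : Δ.Simplex, J.1.card < finrank ℤ L →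
      y + ε • d ∉ Δ.spanCone J := by
    refine eventually_all.2 fun J => eventually_imp_distrib_left.2 fun hJ => ?_
    -- As `d` is outside the span, the line `y + ε d` meets it for at most one `ε`; a nonzero such
    -- `ε₀` is avoided by taking `ε` close to `0`.
    by_cases h : ∃ ε₀ : ℝ, ε₀ ≠ 0 ∧ y + ε₀ • d ∈ Δ.spanCone J
    · obtain ⟨ε₀, h0, hmem⟩ := h
      filter_upwards [nhdsWithin_le_nhds (eventually_ne_nhds h0.symm)] with ε hε hmem'
      have := Submodule.sub_mem _ hmem' hmem
      rw [add_sub_add_left_eq_sub, ← sub_smul] at this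
      exact hd J hJ ((Submodule.smul_mem_iff _ (sub_ne_zero.2 hε)).1 this)
    · filter_upwards [self_mem_nhdsWithin] with ε hε hmem
      exact h ⟨ε, hε, hmem⟩
  obtain ⟨ε, hε⟩ := (h1.and h2).exists
  exact ⟨_, hε⟩

-- A single `y` serves for all `K` at once: a perturbation inside its chamber projects to a generic
-- vector for every `Δ_K`, and leaves no coordinate equal to zero, so closed cone conditions become
-- strict inequalities on `y`.
open Classical in
lemma deg_eq (hΔ : Δ.IsComplete) (y : ℝ ⊗[ℤ] L)
    (hy : ∀ (I : Δ.Facet) (i : I.1), V.dualVec I i y ≠ 0) (K : Δ.Simplex) :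
    Δ.deg K = ∑ I : Δ.Facet with K.1 ⊆ I.1 ∧ ∀ i : I.1, i.1 ∉ K.1 → 0 < V.dualVec I i y, Δ.w I := by
  obtain ⟨y', h1, h2⟩ := V.exists_generic y hy
  have h3 : Δ.IsGenericProj K ((Δ.spanCone K).mkQ y') := fun J hKJ hJ hmem =>
    h2 J hJ (mem_spanCone_of_mkQ_mem hKJ hmem)
  rw [deg, dif_pos (hΔ K), ← (hΔ K).choose_spec _ h3, dProj]
  refine Finset.sum_congr (Finset.filter_congr fun I _ => and_congr_right fun hKI => ?_)
    fun _ _ => rfl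
  rw [V.mkQ_mem_projCone_iff hKI]
  simp only [h1]

/-! ### Assembling the coefficient of `t^{-u}` from the facets. -/

section expansion

open Complex

variable (τ : UpperHalfPlane) (σ : ℂ) (u : Dual ℤ L)

lemma card_le_finrank (J : Δ.Simplex) : J.1.card ≤ finrank ℤ L := by
  rw [← Δ.finrank_cone J.1 J.2, ← Module.finrank_baseChange (R := ℝ) (S := ℤ) (M' := L)]
  exact Submodule.finrank_le _

/-- The contribution of the simplex `J` to `charCoeff`, without sign and degree. -/
noncomputable def simplexCoeff (J : Δ.Simplex) : ℂ :=
  ∑ h : V.H J, eTwoPi (V.fSum J h * σ) * eTwoPi ((u.baseChange ℝ (V.vSum J h) : ℝ) * τ) *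
    ∏ i ∈ J.1, 1 / (1 - eTwoPi σ * eTwoPi τ ^ (u (V.vec i)))

lemma charCoeff_eq :
    V.charCoeff u τ σ = ∑ J : Δ.Simplex, (-1) ^ J.1.card * Δ.deg J * V.simplexCoeff τ σ u J := by
  rw [charCoeff, ← Finset.sum_fiberwise_of_maps_to (s := Finset.univ)
    (t := Finset.range (finrank ℤ L + 1)) (g := fun J : Δ.Simplex => J.1.card)
    (fun J _ => Finset.mem_range.2 (Nat.lt_succ_of_le (card_le_finrank J)))]
  refine Finset.sum_congr rfl fun k _ => Finset.sum_congr rfl fun J hJ => ?_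
  have hk : J.1.card = k := (Finset.mem_filter.1 hJ).2
  rw [simplexCoeff, Finset.mul_sum, hk]
  exact Finset.sum_congr rfl fun h _ => by ring

open Classical in
/-- The coefficient of `t^{-u}` in the expansion of the contribution of the facet `I`, in the
chamber of the vector `y`. -/
noncomputable def facetCoeff (I : Δ.Facet) (y : ℝ ⊗[ℤ] L) : ℂ :=
  ∑ h : V.H I.toSimplex, eTwoPi (V.fSum I.toSimplex h * σ) *
    eTwoPi ((u.baseChange ℝ (V.vSum I.toSimplex h) : ℝ) * τ) *
    ∏ i : I.1, (1 / (1 - eTwoPi σ * eTwoPi τ ^ (u (V.vec i))) -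
      if V.f I.toSimplex h i = 0 ∧ 0 < V.dualVec I i y then 1 else 0)

-- The product over `i ∈ I` is expanded over subsets, all of which are simplices. In the `J`-term
-- the corrections off `J` require integral coordinates there, which restricts the sum to `H_J`, and
-- positivity of `y` off `J`.
open Classical in
lemma facetCoeff_eq (I : Δ.Facet) (y : ℝ ⊗[ℤ] L) :
    (-1) ^ finrank ℤ L * V.facetCoeff τ σ u I y = ∑ J : Δ.Simplex,
      if J.1 ⊆ I.1 ∧ ∀ i : I.1, i.1 ∉ J.1 → 0 < V.dualVec I i y then
        (-1) ^ J.1.card * V.simplexCoeff τ σ u J else 0 := by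
  set x : ι → ℂ := fun i => 1 / (1 - eTwoPi σ * eTwoPi τ ^ (u (V.vec i))) with hx
  set pos : ι → Prop := fun i => ∀ hi : i ∈ I.1, 0 < V.dualVec I ⟨i, hi⟩ y with hpos
  have h1 : V.facetCoeff τ σ u I y = ∑ t ∈ I.1.powerset, ∑ h : V.H I.toSimplex,
      V.expFactor τ σ u I.1 (V.fExt I.toSimplex h) * ((∏ i ∈ t, x i) * ∏ i ∈ I.1 \ t,
        -(if V.fExt I.toSimplex h i = 0 ∧ pos i then 1 else 0)) := by
    rw [Finset.sum_comm, facetCoeff]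
    refine Finset.sum_congr rfl fun h _ => ?_
    rw [← Finset.mul_sum, ← Finset.prod_add, ← Finset.prod_coe_sort I.1]
    refine congrArg₂ (· * ·) (V.expFactor_fExt τ σ u (J := I.toSimplex) subset_rfl h).symm ?_
    refine Finset.prod_congr rfl fun i _ => ?_
    rw [sub_eq_add_neg]
    congr 3
    rw [← V.fExt_coe I.toSimplex h i]
    simp [hpos]
  rw [h1, sum_powerset_facet, Finset.mul_sum]
  refine Finset.sum_congr rfl fun J _ => ?_
  by_cases hJI : J.1 ⊆ I.1
  swap
  · simp [hJI]
  have hcard : I.1.card = finrank ℤ L := (Finset.mem_filter.1 I.2).2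
  -- The `n - |J|` corrections each carry a sign; with the global `(-1)^n` this leaves `(-1)^{|J|}`.
  have hsign : (-1 : ℂ) ^ finrank ℤ L * (-1) ^ (I.1 \ J.1).card = (-1) ^ J.1.card := by
    have h2 : ∀ a b c : ℕ, a + b = c → (-1 : ℂ) ^ c * (-1) ^ a = (-1) ^ b := by
      rintro a b _ rfl
      rw [pow_add, mul_right_comm, ← mul_pow]
      simp
    exact h2 _ _ _ ((Finset.card_sdiff_add_card_eq_card hJI).trans hcard)
  have hprod : ∀ h : V.H I.toSimplex, ∏ i ∈ I.1 \ J.1,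
      -(if V.fExt I.toSimplex h i = 0 ∧ pos i then (1 : ℂ) else 0) =
        if (∀ i : I.1, i.1 ∉ J.1 → 0 < V.dualVec I i y) then
          (if ∀ i ∈ I.1, i ∉ J.1 → V.fExt I.toSimplex h i = 0 then (-1) ^ (I.1 \ J.1).card else 0)
        else 0 := by
    intro h
    rw [Finset.prod_neg, Finset.prod_ite_zero, Finset.prod_const_one, ← ite_and, mul_ite, mul_one,
      mul_zero]
    refine if_congr ?_ rfl rfl
    simp only [Finset.mem_sdiff, hpos, Subtype.forall]
    constructor
    · exact fun hh => ⟨fun i hi hiJ => (hh i ⟨hi, hiJ⟩).2 hi, fun i hi hiJ => (hh i ⟨hi, hiJ⟩).1⟩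
    · exact fun hh i hi => ⟨hh.2 i hi.1 hi.2, fun hi' => hh.1 i hi' hi.2⟩
  simp only [hprod, hJI, if_true, true_and]
  split_ifs with hc
  · have h3 := V.sum_H_facet hJI (V.expFactor τ σ u I.1)
    rw [simplexCoeff]
    simp only [← V.expFactor_fExt τ σ u hJI]
    rw [← Finset.sum_mul, ← h3, Finset.sum_filter, Finset.sum_mul, Finset.mul_sum, Finset.mul_sum,
      ← hsign]
    refine Finset.sum_congr rfl fun h _ => ?_
    split_ifs <;> ring
  · simp

/-- The coefficient in the character formula is assembled from the expansions at the facets. -/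
theorem charCoeff_eq_sum_facetCoeff (hΔ : Δ.IsComplete) (y : ℝ ⊗[ℤ] L)
    (hy : ∀ (I : Δ.Facet) (i : I.1), V.dualVec I i y ≠ 0) :
    V.charCoeff u τ σ =
      ∑ I : Δ.Facet, (Δ.w I : ℂ) * ((-1) ^ finrank ℤ L * V.facetCoeff τ σ u I y) := by
  classical
  simp only [facetCoeff_eq, Finset.mul_sum]
  -- With the sum over `J` outside, the inner sum of weights over `I` is `deg(Δ_J)` evaluated at
  -- `y`.
  rw [Finset.sum_comm, charCoeff_eq]
  refine Finset.sum_congr rfl fun J _ => ?_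
  rw [V.deg_eq hΔ y hy J, Finset.sum_filter]
  push_cast
  rw [Finset.mul_sum, Finset.sum_mul]
  refine Finset.sum_congr rfl fun I _ => ?_
  split_ifs <;> ring

end expansion

end SimplicialMultiFan.GeneratingVectors

/-! ### Products of series, and complex scalars. -/

lemma hasSum_prod_fin {β : Type*} (n : ℕ) {g : Fin n → β → ℂ} {a : Fin n → ℂ}
    (h : ∀ i, HasSum (g i) (a i)) :
    HasSum (fun m : Fin n → β => ∏ i, g i (m i)) (∏ i, a i) := by
  induction n with
  | zero => simp [hasSum_unique]
  | succ n ih =>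
    have h1 := ih fun i => h i.succ
    have hs : Summable fun x : β × (Fin n → β) => g 0 x.1 * ∏ i : Fin n, g i.succ (x.2 i) := by
      have hs0 : Summable fun b => ‖g 0 b‖ := (h 0).summable.norm
      have hs1 : Summable fun m : Fin n → β => ‖∏ i : Fin n, g i.succ (m i)‖ := h1.summable.norm
      exact (hs0.mul_norm hs1).of_norm
    have h2 := (h 0).mul h1 hs
    rw [Fin.prod_univ_succ, ← (Fin.consEquiv fun _ => β).hasSum_iff]
    refine h2.congr_fun fun m => ?_
    simp [Fin.prod_univ_succ, Fin.consEquiv]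

/-- Products of finitely many absolutely convergent series. -/
lemma hasSum_prod_pi {κ β : Type*} [Fintype κ] {g : κ → β → ℂ} {a : κ → ℂ}
    (h : ∀ i, HasSum (g i) (a i)) :
    HasSum (fun m : κ → β => ∏ i, g i (m i)) (∏ i, a i) := by
  have e := (Fintype.equivFin κ).symm
  have h1 := hasSum_prod_fin _ fun i => h (e i)
  rw [Equiv.prod_comp e a] at h1
  rw [← (Equiv.arrowCongr e (Equiv.refl β)).hasSum_iff]
  refine h1.congr_fun fun m => ?_
  simp only [Function.comp]
  rw [← Equiv.prod_comp e]
  simp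

/-- The imaginary part `L_ℂ → L_ℝ`. -/
noncomputable def imPart {L : Type*} [AddCommGroup L] : (ℂ ⊗[ℤ] L) →ₗ[ℤ] (ℝ ⊗[ℤ] L) :=
  LinearMap.rTensor L Complex.imAddGroupHom.toIntLinearMap

lemma imPart_tmul {L : Type*} [AddCommGroup L] (z : ℂ) (x : L) :
    imPart (z ⊗ₜ[ℤ] x) = z.im ⊗ₜ[ℤ] x :=
  rfl

/-! ### Characters of `H_I` and the expansion of the genus. -/

namespace SimplicialMultiFan.GeneratingVectors

variable {ι L : Type*} [AddCommGroup L] {Δ : SimplicialMultiFan ι L} (V : Δ.GeneratingVectors)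
  [Module.Free ℤ L] [Module.Finite ℤ L]

/-- The form `∑ m_i u_i^I` on `L`. -/
noncomputable def facetForm (I : Δ.Facet) (m : I.1 → ℤ) : L →+ ℝ :=
  AddMonoidHom.mk' (fun x => ∑ i, m i * V.dualVec I i ((1 : ℝ) ⊗ₜ[ℤ] x)) fun x y => by
    simp only [TensorProduct.tmul_add, map_add, mul_add, Finset.sum_add_distrib]

lemma facetForm_apply (I : Δ.Facet) (m : I.1 → ℤ) (x : L) :
    V.facetForm I m x = ∑ i, m i * V.dualVec I i ((1 : ℝ) ⊗ₜ[ℤ] x) := rfl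

lemma facetForm_dual (I : Δ.Facet) (u : Dual ℤ L) (x : L) :
    V.facetForm I (fun i => u (V.vec i)) x = u x := by
  have h := congrArg (u.baseChange ℝ) (V.sum_dualVec_smul I ((1 : ℝ) ⊗ₜ[ℤ] x))
  simp only [map_sum, map_smul, Dual.baseChange_apply_tmul, smul_eq_mul, zsmul_eq_mul,
    mul_one] at h
  rw [← h, facetForm_apply]
  exact Finset.sum_congr rfl fun i _ => mul_comm _ _

lemma facetForm_vec (I : Δ.Facet) (m : I.1 → ℤ) (i : I.1) : V.facetForm I m (V.vec i) = m i := by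
  classical
  rw [facetForm_apply]
  simp only [dualVec_vec, mul_ite, mul_one, mul_zero]
  simp

lemma facetForm_mem_int_of_mem_sublattice (I : Δ.Facet) (m : I.1 → ℤ) {x : L}
    (hx : x ∈ V.sublattice I.1) : ∃ k : ℤ, V.facetForm I m x = k := by
  obtain ⟨c, rfl⟩ := (V.mem_sublattice_iff_exists I.1 x).1 hx
  refine ⟨∑ i : I.1, c i * m i, ?_⟩
  rw [← Finset.sum_coe_sort, map_sum]
  push_cast
  refine Finset.sum_congr rfl fun i _ => ?_
  rw [map_zsmul, facetForm_vec, zsmul_eq_mul]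

/-- Identifies `L^*` inside `ℤ^I`, the dual of `L_{I,𝒱}`, as the forms integral on all of `L`. -/
lemma exists_dual_of_facetForm_int (I : Δ.Facet) (m : I.1 → ℤ)
    (h : ∀ x, ∃ k : ℤ, V.facetForm I m x = k) :
    ∃ u : Dual ℤ L, (fun i : I.1 => u (V.vec i)) = m := by
  choose k hk using h
  refine ⟨(AddMonoidHom.mk' k fun x y => ?_).toIntLinearMap, funext fun i => ?_⟩
  · have := map_add (V.facetForm I m) x y
    rw [hk, hk, hk] at this
    exact_mod_cast this
  · have := V.facetForm_vec I m i
    rw [hk] at this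
    exact_mod_cast this

lemma dual_vec_injective (I : Δ.Facet) :
    Function.Injective fun (u : Dual ℤ L) (i : I.1) => u (V.vec i) := by
  intro u u' h
  ext x
  have h1 := V.facetForm_dual I u x
  have h2 := V.facetForm_dual I u' x
  simp only at h
  rw [h, h2] at h1
  exact_mod_cast h1.symm

/-- Orthogonality of the characters of `H_I` given by integral combinations of the `u_i^I`. -/
lemma sum_char_eq_zero (I : Δ.Facet) (m : I.1 → ℤ)
    (hm : ¬∃ u : Dual ℤ L, (fun i : I.1 => u (V.vec i)) = m) :
    ∑ h : V.H I.toSimplex, eTwoPi (-(V.facetForm I m (V.rep h) : ℝ)) = 0 := by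
  obtain ⟨x, hx⟩ : ∃ x, ¬∃ k : ℤ, V.facetForm I m x = k := by
    by_contra! h
    exact hm (V.exists_dual_of_facetForm_int I m h)
  set h0 : V.H I.toSimplex := Submodule.Quotient.mk ⟨x, by rw [latticeOf_facet]; trivial⟩ with hh0
  have h1 : ∀ y : Δ.latticeOf I.toSimplex, eTwoPi (-(V.facetForm I m
      (V.rep (Submodule.Quotient.mk y : V.H I.toSimplex)) : ℝ)) =
        eTwoPi (-(V.facetForm I m y : ℝ)) := by
    intro y
    obtain ⟨k, hk⟩ := V.facetForm_mem_int_of_mem_sublattice I m (V.rep_mk_sub_mem I.toSimplex y)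
    rw [AddSubgroupClass.coe_sub, map_sub, sub_eq_iff_eq_add] at hk
    rw [hk]
    push_cast
    rw [neg_add, eTwoPi_add, ← Int.cast_neg, eTwoPi_int, one_mul]
  have h2 : ∀ h : V.H I.toSimplex, eTwoPi (-(V.facetForm I m (V.rep (h + h0)) : ℝ)) =
      eTwoPi (-(V.facetForm I m (V.rep h) : ℝ)) * eTwoPi (-(V.facetForm I m x : ℝ)) := by
    intro h
    conv_lhs => rw [← V.mk_rep I.toSimplex h, hh0, ← Submodule.Quotient.mk_add, h1,
      AddMemClass.coe_add, map_add]
    push_cast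
    rw [neg_add, eTwoPi_add]
  -- Translation by `h0` permutes `H_I` but multiplies the sum by the character value at `x`, which
  -- is not `1` by the choice of `x`.
  have h3 := Equiv.sum_comp (Equiv.addRight h0)
    fun h : V.H I.toSimplex => eTwoPi (-(V.facetForm I m (V.rep h) : ℝ))
  simp only [Equiv.coe_addRight, h2] at h3
  rw [← Finset.sum_mul] at h3
  by_contra hne
  have h4 := mul_left_cancel₀ hne (h3.trans (mul_one _).symm)
  rw [eTwoPi_eq_one_iff] at h4
  obtain ⟨k, hk⟩ := h4
  refine hx ⟨-k, ?_⟩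
  rw [neg_eq_iff_eq_neg] at hk
  exact_mod_cast hk

lemma sum_char_eq_card (I : Δ.Facet) (u : Dual ℤ L) :
    ∑ h : V.H I.toSimplex, eTwoPi (-(V.facetForm I (fun i => u (V.vec i)) (V.rep h) : ℝ)) =
      Nat.card (V.H I.toSimplex) := by
  simp only [facetForm_dual]
  rw [Finset.sum_congr rfl fun h _ => (by
    rw [Complex.ofReal_intCast, ← Int.cast_neg, eTwoPi_int] :
      eTwoPi (-((u (V.rep h) : ℝ) : ℂ)) = 1)]
  simp

section complexification

lemma dualVecC_tmul (I : Δ.Facet) (i : I.1) (z : ℂ) (x : L) :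
    V.dualVecC I i (z ⊗ₜ[ℤ] x) = z * V.dualVec I i ((1 : ℝ) ⊗ₜ[ℤ] x) := by
  simp [dualVecC]

lemma dualVecC_im (I : Δ.Facet) (i : I.1) (w : ℂ ⊗[ℤ] L) :
    (V.dualVecC I i w).im = V.dualVec I i (imPart w) := by
  induction w using TensorProduct.induction_on with
  | zero => simp
  | add x y hx hy => rw [map_add, Complex.add_im, hx, hy, map_add, map_add]
  | tmul z x =>
    rw [dualVecC_tmul, imPart_tmul, Complex.im_mul_ofReal]
    have : z.im ⊗ₜ[ℤ] x = z.im • ((1 : ℝ) ⊗ₜ[ℤ] x) := by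
      rw [TensorProduct.smul_tmul', smul_eq_mul, mul_one]
    rw [this, map_smul, smul_eq_mul]

lemma baseChange_complex_eq (I : Δ.Facet) (u : Dual ℤ L) (w : ℂ ⊗[ℤ] L) :
    u.baseChange ℂ w = ∑ i : I.1, u (V.vec i) * V.dualVecC I i w := by
  induction w using TensorProduct.induction_on with
  | zero => simp
  | add x y hx hy => simp only [map_add, hx, hy, mul_add, Finset.sum_add_distrib]
  | tmul z x =>
    have h := congrArg (fun r : ℝ => (r : ℂ)) (V.facetForm_dual I u x)
    simp only [facetForm_apply, Complex.ofReal_sum, Complex.ofReal_mul, Complex.ofReal_intCast] at h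
    rw [Dual.baseChange_apply_tmul, zsmul_eq_mul, ← h, Finset.sum_mul]
    refine Finset.sum_congr rfl fun i _ => ?_
    rw [dualVecC_tmul]
    ring

end complexification

variable (τ : UpperHalfPlane) {σ : ℂ}

-- At each vertex the one-variable expansion is used with `d = ⟨u_i,v(h₁)⟩` and `a = ⟨u_i,w⟩ +
-- ⟨u_i,v(h₂)⟩`. The second summand is real, so the inequalities on `Im a` are those of the domain.
open Classical in
lemma hasSum_facet_prod (hσ : ∀ m : ℤ, eTwoPi σ * eTwoPi τ ^ m ≠ 1) {w : ℂ ⊗[ℤ] L}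
    (hw : V.InDomain w τ) (I : Δ.Facet) (h₁ h₂ : V.H I.toSimplex) :
    HasSum (fun m : I.1 → ℤ => ∏ i : I.1, (-jacobiPhi σ τ * (eTwoPi (V.f I.toSimplex h₁ i * σ) *
        eTwoPi (-(m i * (V.dualVecC I i w + V.dualVec I i ((1 : ℝ) ⊗ₜ[ℤ] (V.rep h₂ : L))))) *
        eTwoPi (m i * V.f I.toSimplex h₁ i * τ) * (1 / (1 - eTwoPi σ * eTwoPi τ ^ (m i)) -
          if V.f I.toSimplex h₁ i = 0 ∧ 0 < V.dualVec I i (imPart w) then 1 else 0))))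
      (∏ i : I.1, eTwoPi (V.dualVec I i ((1 : ℝ) ⊗ₜ[ℤ] (V.rep h₁ : L)) * σ) *
        ellPhi (V.dualVecC I i
          (-w + (τ : ℂ) ⊗ₜ[ℤ] (V.rep h₁ : L) - (1 : ℂ) ⊗ₜ[ℤ] (V.rep h₂ : L))) τ σ) := by
  refine hasSum_prod_pi (g := fun (i : I.1) (m : ℤ) => -jacobiPhi σ τ *
    (eTwoPi (V.f I.toSimplex h₁ i * σ) *
        eTwoPi (-(m * (V.dualVecC I i w + V.dualVec I i ((1 : ℝ) ⊗ₜ[ℤ] (V.rep h₂ : L))))) *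
        eTwoPi (m * V.f I.toSimplex h₁ i * τ) * (1 / (1 - eTwoPi σ * eTwoPi τ ^ m) -
          if V.f I.toSimplex h₁ i = 0 ∧ 0 < V.dualVec I i (imPart w) then 1 else 0))) fun i => ?_
  obtain ⟨hy0, hy1, hyf⟩ := hw I i
  have hyf' := hyf h₁
  rw [V.f_facet I h₁ i] at hyf' ⊢
  have him : (V.dualVecC I i w + V.dualVec I i ((1 : ℝ) ⊗ₜ[ℤ] (V.rep h₂ : L))).im =
      (V.dualVecC I i w).im := by simp
  rw [← him] at hy0 hy1 hyf'
  have key := hasSum_ellPhi_fract τ hy0 hy1 hyf' hσ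
  rw [him, dualVecC_im] at key
  convert key using 3
  simp only [map_sub, map_add, map_neg, dualVecC_tmul]
  ring

open Classical in
/-- The expansion of the contribution of a facet to the orbifold elliptic genus. -/
lemma hasSum_facet (hσ : ∀ m : ℤ, eTwoPi σ * eTwoPi τ ^ m ≠ 1) {w : ℂ ⊗[ℤ] L}
    (hw : V.InDomain w τ) (I : Δ.Facet) :
    HasSum (fun u : Dual ℤ L => eTwoPi (-u.baseChange ℂ w) *
        ((Δ.w I : ℂ) * ((-1) ^ finrank ℤ L * V.facetCoeff τ σ u I (imPart w))) *
          jacobiPhi σ τ ^ finrank ℤ L)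
      (((Δ.w I : ℂ) / (Nat.card (V.H I.toSimplex) : ℂ)) *
    ∑ h : V.H I.toSimplex × V.H I.toSimplex, ∏ i : I.1,
      eTwoPi (V.dualVec I i ((1 : ℝ) ⊗ₜ[ℤ] (V.rep h.1 : L)) * σ) *
        ellPhi (V.dualVecC I i
          (-w + (τ : ℂ) ⊗ₜ[ℤ] (V.rep h.1 : L) - (1 : ℂ) ⊗ₜ[ℤ] (V.rep h.2 : L))) τ σ) := by
  have hcard : Fintype.card I.1 = finrank ℤ L := by
    rw [Fintype.card_coe]; exact (Finset.mem_filter.1 I.2).2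
  have hH : (Nat.card (V.H I.toSimplex) : ℂ) ≠ 0 := by
    rw [Nat.cast_ne_zero]; exact Nat.card_pos.ne'
  set G : (I.1 → ℤ) → V.H I.toSimplex → ℂ := fun m h₁ =>
    (-jacobiPhi σ τ) ^ finrank ℤ L * eTwoPi (V.fSum I.toSimplex h₁ * σ) *
      eTwoPi (-∑ i, m i * V.dualVecC I i w) * eTwoPi ((∑ i, m i * V.f I.toSimplex h₁ i : ℝ) * τ) *
      ∏ i : I.1, (1 / (1 - eTwoPi σ * eTwoPi τ ^ (m i)) -
        if V.f I.toSimplex h₁ i = 0 ∧ 0 < V.dualVec I i (imPart w) then 1 else 0) with hG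
  have h1 := (hasSum_sum (s := Finset.univ) fun (h : V.H I.toSimplex × V.H I.toSimplex) _ =>
    V.hasSum_facet_prod τ hσ hw I h.1 h.2).mul_left
      ((Δ.w I : ℂ) / (Nat.card (V.H I.toSimplex) : ℂ))
  -- The class `h₂` enters only through the exponential of `⟨u_i,v(h₂)⟩`, so the double sum factors
  -- and a character sum splits off.
  have h2 : ∀ m : I.1 → ℤ, (∑ h : V.H I.toSimplex × V.H I.toSimplex,
      ∏ i : I.1, (-jacobiPhi σ τ * (eTwoPi (V.f I.toSimplex h.1 i * σ) *
        eTwoPi (-(m i * (V.dualVecC I i w + V.dualVec I i ((1 : ℝ) ⊗ₜ[ℤ] (V.rep h.2 : L))))) *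
        eTwoPi (m i * V.f I.toSimplex h.1 i * τ) * (1 / (1 - eTwoPi σ * eTwoPi τ ^ (m i)) -
          if V.f I.toSimplex h.1 i = 0 ∧ 0 < V.dualVec I i (imPart w) then 1 else 0)))) =
      (∑ h₁, G m h₁) * ∑ h₂ : V.H I.toSimplex, eTwoPi (-(V.facetForm I m (V.rep h₂) : ℝ)) := by
    intro m
    rw [Finset.sum_mul_sum, Fintype.sum_prod_type]
    refine Finset.sum_congr rfl fun h₁ _ => Finset.sum_congr rfl fun h₂ _ => ?_
    simp only [Finset.prod_mul_distrib, Finset.prod_const, Finset.card_univ, hcard, hG,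
      ← eTwoPi_sum]
    have e1 : ∑ i : I.1, -(m i * (V.dualVecC I i w +
        V.dualVec I i ((1 : ℝ) ⊗ₜ[ℤ] (V.rep h₂ : L)))) =
        (-∑ i, m i * V.dualVecC I i w) + -(V.facetForm I m (V.rep h₂) : ℝ) := by
      rw [facetForm_apply]
      push_cast
      rw [← neg_add, ← Finset.sum_add_distrib, ← Finset.sum_neg_distrib]
      simp only [mul_add]
    have e2 : (∑ i : I.1, (V.f I.toSimplex h₁ i : ℂ) * σ) = V.fSum I.toSimplex h₁ * σ := by
      rw [fSum]
      push_cast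
      rw [Finset.sum_mul]
      rfl
    have e3 : (∑ i : I.1, (m i * V.f I.toSimplex h₁ i * τ : ℂ)) =
        (∑ i, m i * V.f I.toSimplex h₁ i : ℝ) * τ := by
      push_cast
      rw [Finset.sum_mul]
    rw [e1, e2, e3, eTwoPi_add]
    ring
  simp only [h2] at h1
  -- Terms with `m` outside the image of `L^*` vanish by orthogonality; on the image the character
  -- sum is `|H_I|` and cancels the denominator.
  rw [← (V.dual_vec_injective I).hasSum_iff] at h1
  · refine h1.congr_fun fun u => ?_
    simp only [Function.comp]
    have e0 : ∀ a b c : ℂ, c ≠ 0 → b / c * (a * c) = b * a := fun a b c hc => by field_simp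
    rw [sum_char_eq_card, e0 _ _ _ hH, facetCoeff, Finset.mul_sum, Finset.mul_sum,
      Finset.mul_sum, Finset.mul_sum, Finset.sum_mul]
    refine Finset.sum_congr rfl fun h _ => ?_
    have e4 : u.baseChange ℝ (V.vSum I.toSimplex h) =
        ∑ i : I.1, u (V.vec i) * V.f I.toSimplex h i := by
      rw [baseChange_vSum, ← Finset.sum_coe_sort]
      refine Finset.sum_congr rfl fun i _ => ?_
      rw [mul_comm, ← V.fExt_coe I.toSimplex h i]
    rw [hG, e4, V.baseChange_complex_eq I u w, neg_pow (jacobiPhi σ τ)]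
    ring
  · intro m hm
    rw [V.sum_char_eq_zero I m hm, mul_zero, mul_zero]

/-- The chamber vector `Im w` is common to all facets, and the domain keeps it off every wall, so
the facet expansions add up termwise to the degree formula. -/
theorem hasSum_orbEllGenus (hΔ : Δ.IsComplete) (hσ : ∀ m : ℤ, eTwoPi σ * eTwoPi τ ^ m ≠ 1)
    {w : ℂ ⊗[ℤ] L} (hw : V.InDomain w τ) :
    HasSum (fun u : Dual ℤ L => eTwoPi (-u.baseChange ℂ w) * V.charCoeff u τ σ *
      jacobiPhi σ τ ^ finrank ℤ L) (V.orbEllGenus w τ σ) := by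
  refine (hasSum_sum (s := Finset.univ) fun (I : Δ.Facet) _ =>
    V.hasSum_facet τ hσ hw I).congr_fun fun u => ?_
  rw [V.charCoeff_eq_sum_facetCoeff τ σ u hΔ (imPart w) fun I i => by
    rw [← dualVecC_im]; exact abs_pos.1 (hw I i).1]
  rw [Finset.mul_sum, Finset.sum_mul]

end SimplicialMultiFan.GeneratingVectors

theorem mainTheorem4 {ι L : Type*} [AddCommGroup L] [Module.Free ℤ L] [Module.Finite ℤ L]
    (Δ : SimplicialMultiFan ι L) (hΔ : Δ.IsComplete) (V : Δ.GeneratingVectors)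
    (τ : UpperHalfPlane) (σ : ℂ) (hσ : ∀ m : ℤ, eTwoPi σ * eTwoPi τ ^ m ≠ 1) :
    (∀ w : ℂ ⊗[ℤ] L, V.InDomain w τ →
      HasSum
        (fun u : Module.Dual ℤ L =>
          eTwoPi (-u.baseChange ℂ w) *
            V.charCoeff u τ σ * jacobiPhi σ τ ^ Module.finrank ℤ L)
        (V.orbEllGenus w τ σ)) ∧
    (∀ x ∈ V.commonLattice, V.IsGeneric x → ∀ z : ℂ, V.InDomain (z ⊗ₜ[ℤ] x) τ →
      HasSum
        (fun u : Module.Dual ℤ L =>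
          eTwoPi (-((u x : ℂ) * z)) * V.charCoeff u τ σ * jacobiPhi σ τ ^ Module.finrank ℤ L)
        (V.orbEllGenusAlong x z τ σ)) := by
  refine ⟨fun w hw => V.hasSum_orbEllGenus τ hΔ hσ hw, fun x _ _ z hz => ?_⟩
  -- The genus along `x` is by definition the equivariant one at `w = z ⊗ x`, where `⟨u,w⟩ = u(x)
  -- z`.
  have h := V.hasSum_orbEllGenus τ hΔ hσ hz
  simp only [Module.Dual.baseChange_apply_tmul, zsmul_eq_mul] at h
  exact h
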